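/- Let $d\ge 1$, let $\Gamma$ be an irreducible co-compact lattice in $\mathcal G=\mathrm{PSL}(2,\mathbb R)^d$ (discrete, $\Gamma\backslash\mathcal G$ compact, and the projection of $\Gamma$ to $\mathcal G/N$ dense for every nontrivial normal subgroup $N$), let $Y=\Gamma\backslash\mathcal G$ with the measure $dg$ induced by a Haar measure of $\mathcal G$, and put $\langle f,h\rangle_Y=\int_Y f\bar h\,dg$. Write $K_j=\{k_\theta\}$, $k_\theta=\begin{pmatrix}\cos\theta&\sin\theta\\-\sin\theta&\cos\theta\end{pmatrix}$, for the maximal compact subgroup of the $j$-th factor, and let $W_j,H_j,X_j$ be the derivatives along right translation on the $j$-th factor generated by $\begin{pmatrix}0&1\\-1&0\end{pmatrix},\begin{pmatrix}1&0\\0&-1\end{pmatrix},\begin{pmatrix}0&1\\0&0\end{pmatrix}$, and $E_j^{\pm}=H_j\pm i(2X_j-W_j)$. Let $\phi$ be a smooth $\Gamma$-invariant function on $\mathbb H^d$ that is a joint eigenfunction of the partial Laplacians $\triangle_j=y_j^2(\partial_{x_j}^2+\partial_{y_j}^2)$, $(\triangle_j+\tfrac14+r_j^2)\phi=0$ for $1\le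 j\le d$, with $r_j\ge 0$ or $r_j\in i(0,\tfrac12]$, normalized so that $\phi_0(g)=\phi(g(i))$ has norm $1$ in $L^2(Y)$. Define $\phi_n$, $n\in\mathbb Z^d$, on $Y$ inductively from $\phi_0$ by $\phi_{n\pm e_j}=\frac{1}{2ir_j+1\pm 2n_j}E_j^{\pm}\phi_n$ (a quotient with zero denominator, which occurs only for $r_j=i/2$, is read as $0$), and set $$S_\phi(a)=\lim_{N\to\infty}\Big\langle a\sum_{\|n\|_\infty\le N}\phi_n,\ \phi_0\Big\rangle_Y .$$ Proposition. To every such $\phi$ and every subset $\mathcal J\subseteq\{1,\dots,d\}$ one can attach a function $\Phi_{\mathcal J}=\Phi_{\phi,\mathcal J}\in L^2(Y)$ with $\|\Phi_{\mathcal J}\|_{L^2(Y)}=1$, such that for every $\mathcal J$ and every $a\in C^\infty(Y)$ that is invariant under $\prod_{j\notin\mathcal J}K_j$ there is a constant $C$ (independent of $\phi$) such that for every $\phi$ as above whose parameters $r_j$, $j\in\mathcal J$, are real and positive, the limit defining $S_\phi(a)$ exists and $$\big|S_\phi(a)-\langle a\Phi_{\mathcal J},\Phi_{\mathcal J}\rangle_Y\big|\le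 C\max_{j\in\mathcal J} r_j^{-1/4},$$ where the maximum over the empty set is $0$. In particular $S_\phi$ is asymptotically a positive measure on such functions: if $a\ge 0$, then also $\operatorname{Re}S_\phi(a)\ge -C\max_{j\in\mathcal J} r_j^{-1/4}$ and $|\operatorname{Im}S_\phi(a)|\le C\max_{j\in\mathcal J} r_j^{-1/4}$. -/

import Mathlib

open MeasureTheory Filter Topology
open scoped MatrixGroups ContDiff UpperHalfPlane ComplexConjugate

noncomputable section

namespace MicrolocalLift

/-! ## The group `PSL(2, ℝ)^d` and its action on `ℍ^d` -/

theorem center_smul {A : SL(2, ℝ)} (hA : A ∈ Subgroup.center SL(2, ℝ)) (z : ℍ) : A • z = z := by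
  obtain ⟨r, hr, hs⟩ := Matrix.SpecialLinearGroup.mem_center_iff.mp hA
  have hr0 : (r : ℂ) ≠ 0 := by
    rintro h
    have h' : r = 0 := by exact_mod_cast h
    simp [h'] at hr
  have e00 : A 0 0 = r := by rw [← hs]; simp
  have e01 : A 0 1 = 0 := by rw [← hs]; simp
  have e10 : A 1 0 = 0 := by rw [← hs]; simp
  have e11 : A 1 1 = r := by rw [← hs]; simp
  ext
  rw [UpperHalfPlane.coe_specialLinearGroup_apply, e00, e01, e10, e11]
  simp [hr0]

/-- The action of `PSL(2, ℝ)` on the upper half plane by Möbius transformations. -/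
instance pslAction : MulAction PSL(2, ℝ) ℍ where
  smul g z := Quotient.liftOn' g (fun A : SL(2, ℝ) => A • z) (by
    intro A B hAB
    have h := center_smul (QuotientGroup.leftRel_apply.mp hAB) z
    change A • z = B • z
    rw [mul_smul, inv_smul_eq_iff] at h
    exact h.symm)
  one_smul z := one_smul SL(2, ℝ) z
  mul_smul g h z := by
    induction g using QuotientGroup.induction_on
    induction h using QuotientGroup.induction_on
    exact mul_smul (α := SL(2, ℝ)) _ _ z

/-- The Borel σ-algebra on `PSL(2, ℝ)`, which carries the quotient topology. -/
instance pslMeasurableSpace : MeasurableSpace PSL(2, ℝ) := borel _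

instance pslBorelSpace : BorelSpace PSL(2, ℝ) := ⟨rfl⟩

instance slSecondCountable : SecondCountableTopology SL(2, ℝ) :=
  haveI : SecondCountableTopology (Matrix (Fin 2) (Fin 2) ℝ) :=
    inferInstanceAs (SecondCountableTopology (Fin 2 → Fin 2 → ℝ))
  TopologicalSpace.Subtype.secondCountableTopology {A : Matrix (Fin 2) (Fin 2) ℝ | A.det = 1}

/-- The group `𝒢 = PSL(2, ℝ)^d`. -/
abbrev G (d : ℕ) : Type := Fin d → PSL(2, ℝ)

variable {d : ℕ}

/-- The class in `PSL(2, ℝ)` of `A / √(det A)`, for a real matrix `A` with `det A > 0`. -/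
def ofPosDet (A : Fin 2 → Fin 2 → ℝ) : PSL(2, ℝ) :=
  if h : 0 < (Matrix.of A).det then
    QuotientGroup.mk (⟨(√(Matrix.of A).det)⁻¹ • Matrix.of A, by
      rw [Matrix.det_smul, Fintype.card_fin, inv_pow, Real.sq_sqrt h.le, inv_mul_cancel₀ h.ne']⟩ :
        SL(2, ℝ))
  else 1

/-- The one-parameter group `exp (t W) = k_t`, `W = [[0, 1], [-1, 0]]`. -/
def expW (t : ℝ) : PSL(2, ℝ) :=
  QuotientGroup.mk (⟨!![Real.cos t, Real.sin t; -Real.sin t, Real.cos t], by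
    rw [Matrix.det_fin_two_of]; nlinarith [Real.sin_sq_add_cos_sq t]⟩ : SL(2, ℝ))

/-- The one-parameter group `exp (t H)`, `H = [[1, 0], [0, -1]]`. -/
def expH (t : ℝ) : PSL(2, ℝ) :=
  QuotientGroup.mk (⟨!![Real.exp t, 0; 0, Real.exp (-t)], by
    rw [Matrix.det_fin_two_of, ← Real.exp_add]; simp⟩ : SL(2, ℝ))

/-- The one-parameter group `exp (t X)`, `X = [[0, 1], [0, 0]]`. -/
def expX (t : ℝ) : PSL(2, ℝ) :=
  QuotientGroup.mk (⟨!![1, t; 0, 1], by rw [Matrix.det_fin_two_of]; simp⟩ : SL(2, ℝ))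

/-! ## Irreducible co-compact lattices and the space `Y = Γ \ 𝒢` -/

/-- `Y = Γ \ 𝒢`, the orbit space of `Γ` acting on `𝒢` by left multiplication, with the quotient
topology and the quotient σ-algebra. -/
abbrev Y (Γ : Subgroup (G d)) : Type := MulAction.orbitRel.Quotient Γ (G d)

/-- The projection `𝒢 → Γ \ 𝒢`. -/
def proj (Γ : Subgroup (G d)) (g : G d) : Y Γ := Quotient.mk'' g

/-- `Γ` is an irreducible co-compact lattice in `𝒢`: it is discrete, `Γ \ 𝒢` is compact, and for
every nontrivial normal subgroup `N` of `𝒢` the projection of `Γ` to `𝒢 / N` is dense. -/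
structure IsIrreducibleCocompactLattice (Γ : Subgroup (G d)) : Prop where
  discrete : DiscreteTopology Γ
  cocompact : CompactSpace (Y Γ)
  irreducible : ∀ N : Subgroup (G d), N.Normal → N ≠ ⊥ →
    Dense ((QuotientGroup.mk : G d → G d ⧸ N) '' (Γ : Set (G d)))

/-- A discrete subgroup of `𝒢` has a (Borel) fundamental domain. -/
theorem exists_isFundamentalDomain (Γ : Subgroup (G d)) [DiscreteTopology Γ] (μ : Measure (G d)) :
    ∃ D : Set (G d), IsFundamentalDomain Γ D μ := by
  obtain ⟨U, hU, hU1⟩ : ∃ U : Set (G d), IsOpen U ∧ ((↑) : Γ → G d) ⁻¹' U = {1} :=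
    isOpen_induced_iff.mp (isOpen_discrete ({1} : Set Γ))
  have h1U : (1 : G d) ∈ U := by
    have : (1 : Γ) ∈ ((↑) : Γ → G d) ⁻¹' U := by rw [hU1]; rfl
    simpa using this
  have hloc : ∀ x : G d, ∃ V : Set (G d), IsOpen V ∧ x ∈ V ∧
      ∀ γ : Γ, ∀ v ∈ V, γ • v ∈ V → γ = 1 := by
    intro x
    have hc : Continuous fun p : G d × G d => p.1 * p.2⁻¹ := by fun_prop
    have hn : (fun p : G d × G d => p.1 * p.2⁻¹) ⁻¹' U ∈ 𝓝 (x, x) :=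
      (hU.preimage hc).mem_nhds (by simpa using h1U)
    rw [nhds_prod_eq, mem_prod_same_iff] at hn
    obtain ⟨t, ht, hsub⟩ := hn
    obtain ⟨V, hVt, hVo, hxV⟩ := mem_nhds_iff.mp ht
    refine ⟨V, hVo, hxV, fun γ v hv hγ => ?_⟩
    have hm : (γ • v) * v⁻¹ ∈ U := hsub (Set.mk_mem_prod (hVt hγ) (hVt hv))
    have hm' : γ ∈ ((↑) : Γ → G d) ⁻¹' U := by
      simpa [Subgroup.smul_def] using hm
    rw [hU1] at hm'
    exact hm'
  choose V hVo hxV hV using hloc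
  obtain ⟨s, hs, hcov⟩ := TopologicalSpace.countable_cover_nhds
    fun x => (hVo x).mem_nhds (hxV x)
  have hsne : s.Nonempty := by
    by_contra h
    rw [Set.not_nonempty_iff_eq_empty] at h
    simp [h] at hcov
    exact Set.empty_ne_univ hcov
  obtain ⟨u, rfl⟩ := hs.exists_eq_range hsne
  have hcov' : ∀ x : G d, ∃ n, x ∈ V (u n) := by
    intro x
    have : x ∈ ⋃ y ∈ Set.range u, V y := by rw [hcov]; trivial
    simpa using this
  refine ⟨⋃ n, (V (u n) \ {x | ∃ m < n, ∃ γ : Γ, γ • x ∈ V (u m)}), IsFundamentalDomain.mk'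
    (MeasurableSet.nullMeasurableSet ?_) ?_⟩
  · refine MeasurableSet.iUnion fun n => (hVo _).measurableSet.diff (IsOpen.measurableSet ?_)
    have : {x : G d | ∃ m < n, ∃ γ : Γ, γ • x ∈ V (u m)} =
        ⋃ m < n, ⋃ γ : Γ, (fun x : G d => (γ : G d) * x) ⁻¹' V (u m) := by
      ext x; simp [Subgroup.smul_def]
    rw [this]
    exact isOpen_biUnion fun m _ => isOpen_iUnion fun γ =>
      (hVo _).preimage (continuous_const_mul (γ : G d))
  · intro x
    classical
    have hex : ∃ n, ∃ γ : Γ, γ • x ∈ V (u n) := by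
      obtain ⟨n, hn⟩ := hcov' x
      exact ⟨n, 1, by simpa using hn⟩
    obtain ⟨γ, hγ⟩ := Nat.find_spec hex
    refine ⟨γ, ?_, ?_⟩
    · refine Set.mem_iUnion.mpr ⟨Nat.find hex, hγ, ?_⟩
      rintro ⟨m, hm, δ, hδ⟩
      exact Nat.find_min hex hm ⟨δ * γ, by rwa [mul_smul]⟩
    · intro δ hδ
      obtain ⟨n, hn, hn'⟩ := Set.mem_iUnion.mp hδ
      have hle : n = Nat.find hex := by
        refine le_antisymm (not_lt.mp fun hlt => hn' ⟨_, hlt, γ * δ⁻¹, ?_⟩)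
          (Nat.find_min' hex ⟨δ, hn⟩)
        rw [smul_smul, inv_mul_cancel_right]
        exact hγ
      subst hle
      have := hV (u (Nat.find hex)) (δ * γ⁻¹) (γ • x) hγ (by
        rw [smul_smul, inv_mul_cancel_right]; exact hn)
      exact mul_inv_eq_one.mp this

open Classical in
/-- The measure on `Γ \ 𝒢` induced by a Haar measure `μ` on `𝒢`: the image of the restriction of
`μ` to a fundamental domain of `Γ`. When `Γ` is discrete a fundamental domain exists
(`exists_isFundamentalDomain`), and the measure does not depend on its choice. -/
def quotientMeasure (Γ : Subgroup (G d)) (μ : Measure (G d)) : Measure (Y Γ) :=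
  if h : ∃ D : Set (G d), IsFundamentalDomain Γ D μ then
    (μ.restrict h.choose).map (proj Γ)
  else 0

/-- Right translation by `h` on `Γ \ 𝒢`. -/
def translate (Γ : Subgroup (G d)) (y : Y Γ) (h : G d) : Y Γ :=
  Quotient.map' (fun g => g * h) (by
    rintro a b ⟨γ, rfl⟩
    exact ⟨γ, (mul_assoc _ _ _).symm⟩) y

variable {Γ : Subgroup (G d)}

/-- `f ∈ C^∞(Y)`. As `GL⁺(2, ℝ)^d → 𝒢`, `A ↦ (A_j / √(det A_j))_j`, is a smooth surjective
submersion (a surjective homomorphism of Lie groups), a function on `𝒢` is smooth exactly when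
its composition with this map is smooth on the open set `GL⁺(2, ℝ)^d` of `d`-tuples of matrices. -/
def IsSmooth (f : Y Γ → ℂ) : Prop :=
  ContDiffOn ℝ ∞ (fun A : Fin d → Fin 2 → Fin 2 → ℝ => f (proj Γ fun j => ofPosDet (A j)))
    {A | ∀ j, 0 < (Matrix.of (A j)).det}

/-- `f` is right-invariant under the maximal compact subgroup `K_j = {k_θ}` of the `j`-th factor. -/
def IsInvariantUnderK (j : Fin d) (f : Y Γ → ℂ) : Prop :=
  ∀ (θ : ℝ) (y : Y Γ), f (translate Γ y (Pi.mulSingle j (expW θ))) = f y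

/-! ## The raising and lowering operators -/

/-- Derivative of `f` along the right translations by `e t` on the `j`-th factor. -/
def lieDeriv (e : ℝ → PSL(2, ℝ)) (j : Fin d) (f : Y Γ → ℂ) (y : Y Γ) : ℂ :=
  deriv (fun t : ℝ => f (translate Γ y (Pi.mulSingle j (e t)))) 0

/-- `E_j⁺ = H_j + i (2 X_j - W_j)`. -/
def Eplus (j : Fin d) (f : Y Γ → ℂ) (y : Y Γ) : ℂ :=
  lieDeriv expH j f y + Complex.I * (2 * lieDeriv expX j f y - lieDeriv expW j f y)

/-- `E_j⁻ = H_j - i (2 X_j - W_j)`. -/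
def Eminus (j : Fin d) (f : Y Γ → ℂ) (y : Y Γ) : ℂ :=
  lieDeriv expH j f y - Complex.I * (2 * lieDeriv expX j f y - lieDeriv expW j f y)

/-- `m` steps of `φ_{n + e_j} = (2 i r_j + 1 + 2 n_j)⁻¹ E_j⁺ φ_n`, from `n_j = 0` to `n_j = m`. -/
def raise (j : Fin d) (r : ℂ) : ℕ → (Y Γ → ℂ) → (Y Γ → ℂ)
  | 0, f => f
  | m + 1, f => fun y => Eplus j (raise j r m f) y / (2 * Complex.I * r + 1 + 2 * (m : ℂ))

/-- `m` steps of `φ_{n - e_j} = (2 i r_j + 1 - 2 n_j)⁻¹ E_j⁻ φ_n`, from `n_j = 0` to `n_j = -m`. -/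
def lower (j : Fin d) (r : ℂ) : ℕ → (Y Γ → ℂ) → (Y Γ → ℂ)
  | 0, f => f
  | m + 1, f => fun y => Eminus j (lower j r m f) y / (2 * Complex.I * r + 1 - 2 * (-(m : ℂ)))

/-- Move the `j`-th index from `0` to `n`. -/
def shift (j : Fin d) (r : ℂ) (n : ℤ) (f : Y Γ → ℂ) : Y Γ → ℂ :=
  if 0 ≤ n then raise j r n.toNat f else lower j r (-n).toNat f

/-! ## Joint Laplacian eigenfunctions on `X = Γ \ ℍ^d` -/

/-- The partial Laplacian `Δ_j = y_j² (∂²/∂x_j² + ∂²/∂y_j²)` on `ℍ^d`. -/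
def partialLaplacian (j : Fin d) (φ : (Fin d → ℍ) → ℂ) (z : Fin d → ℍ) : ℂ :=
  ((z j).im : ℂ) ^ 2 *
    (iteratedDeriv 2 (fun x : ℝ =>
        φ (Function.update z j (UpperHalfPlane.ofComplex (x + (z j).im * Complex.I)))) (z j).re +
     iteratedDeriv 2 (fun y : ℝ =>
        φ (Function.update z j (UpperHalfPlane.ofComplex ((z j).re + y * Complex.I)))) (z j).im)

/-- A `Γ`-invariant function on `ℍ^d`, as the function `φ_0(Γ g) = φ(g(i))` on `Y`. -/
def pullback (φ : (Fin d → ℍ) → ℂ) (hφ : ∀ γ ∈ Γ, ∀ z, φ (fun j => γ j • z j) = φ z) : Y Γ → ℂ :=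
  Quotient.lift (fun g : G d => φ fun j => g j • UpperHalfPlane.I) (by
    rintro a b ⟨γ, rfl⟩
    rw [← hφ γ γ.2 (fun j => b j • UpperHalfPlane.I)]
    exact congrArg φ (funext fun j => mul_smul (γ.1 j) (b j) UpperHalfPlane.I))

/-- A smooth `L²`-normalized joint eigenfunction `φ` of the partial Laplacians on `X = Γ \ ℍ^d`,
with spectral parameters `r`: `(Δ_j + 1/4 + r_j²) φ = 0`, where `r_j ≥ 0` when the eigenvalue
`1/4 + r_j²` is at least `1/4` and `r_j ∈ i (0, 1/2]` otherwise (`r_j = i / 2` is the eigenvalue `0`,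
which occurs for constants). The norm is that of `L²(Y)`, where functions on `X` are regarded as
`K`-invariant functions on `Y`. -/
structure LaplaceEigenfunction (Γ : Subgroup (G d)) (μ : Measure (G d)) where
  toFun : (Fin d → ℍ) → ℂ
  r : Fin d → ℂ
  invariant : ∀ γ ∈ Γ, ∀ z, toFun (fun j => γ j • z j) = toFun z
  smooth : ContDiffOn ℝ ∞ (fun w : Fin d → ℂ => toFun fun j => UpperHalfPlane.ofComplex (w j))
    {w | ∀ j, 0 < (w j).im}
  eigen : ∀ j z, partialLaplacian j toFun z + (1 / 4 + r j ^ 2) * toFun z = 0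
  parameter : ∀ j, ((r j).im = 0 ∧ 0 ≤ (r j).re) ∨
    ((r j).re = 0 ∧ 0 < (r j).im ∧ (r j).im ≤ 1 / 2)
  normalized : ∫ y, ‖pullback toFun invariant y‖ ^ 2 ∂(quotientMeasure Γ μ) = 1

/-! ## The micro local lift -/

variable {μ : Measure (G d)}

/-- The functions `φ_n`, `n ∈ ℤ^d`, on `Y`. They are given by
`φ_{n ± e_j} = (2 i r_j + 1 ± 2 n_j)⁻¹ E_j^± φ_n`, starting from `φ_0(g) = φ(g(i))`. -/
def LaplaceEigenfunction.fn (φ : LaplaceEigenfunction Γ μ) (n : Fin d → ℤ) : Y Γ → ℂ :=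
  (List.finRange d).foldl (fun f j => shift j (φ.r j) (n j) f) (pullback φ.toFun φ.invariant)

/-- `⟨a ∑_{‖n‖_∞ ≤ N} φ_n, φ_0⟩_Y`. -/
def LaplaceEigenfunction.partialLift (φ : LaplaceEigenfunction Γ μ) (a : Y Γ → ℂ) (N : ℕ) : ℂ :=
  ∫ y, a y * (∑ n ∈ Finset.Icc (fun _ : Fin d => -(N : ℤ)) (fun _ => (N : ℤ)), φ.fn n y) *
    conj (φ.fn 0 y) ∂(quotientMeasure Γ μ)

/-- The micro local lift `S_φ(a) = lim_{N → ∞} ⟨a ∑_{‖n‖_∞ ≤ N} φ_n, φ_0⟩_Y`. -/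
def LaplaceEigenfunction.lift (φ : LaplaceEigenfunction Γ μ) (a : Y Γ → ℂ) : ℂ :=
  limUnder atTop (φ.partialLift a)

end MicrolocalLift

end

/-!
The micro local lift of a joint eigenfunction `φ` is compared with the states `⟨a Φ, Φ⟩` in which
`Φ = |B|^{-1/2} ∑_{n ∈ B} φ_n` is a normalized sum over the box `B` of all `n` supported on `J` with
`‖n‖_∞ ≤ N`.

In the coordinates `GL⁺(2, ℝ)^d → Γ \ 𝒢` the derivatives `H_j, X_j, W_j` are directional derivatives
along linear vector fields, so that the commutation relations of the Lie algebra follow from the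
symmetry of second derivatives (`lieComb_bracket`). On the `K`-invariant function `φ_0` the operator
`E_j⁻ E_j⁺` is four times the Laplacian (`LaplaceEigenfunction.Eminus_Eplus_base`); together with
`[E_j⁻, E_j⁺] = 4 i W_j` this gives `E_j^± φ_n = (2 i r_j + 1 ± 2 n_j) φ_{n ± e_j}` for all `n`
if `r_j` is real (`Eplus_fn`, `Eminus_fn`).

The measure of `Γ \ 𝒢` is finite and invariant under right translations
(`measurePreserving_translate`), so derivatives can be integrated by parts in the matrix
coefficients `⟨a φ_n, φ_m⟩`.
* With `W_j` one finds that they decay at least like `∏_j (1 + (n_j - m_j)²)⁻¹` (`exists_decay`), and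
  that for `K_j`-invariant `a` they vanish unless `n_j = m_j`.
* With `E_j⁺` one finds that `⟨a φ_{n + e_j}, φ_{m + e_j}⟩` is
  `(2 i r_j + 1 + 2 m_j) / (2 i r_j + 1 + 2 n_j)` times `⟨a φ_n, φ_m⟩`, up to `O(1 / r_j)`. For `a = 1`
  there is no error, and the `φ_n` are orthonormal; in general, shifting both indices costs
  `O(1 / r_j)` times the decaying weight (`exists_shift_bound`).

Hence `⟨a Φ, Φ⟩ = |B|⁻¹ ∑_{n, m ∈ B} ⟨a φ_n, φ_m⟩` is `∑_k ⟨a φ_k, φ_0⟩`, which is the lift, up to an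
error `O(N / r_j)` from shifting `(k + m, m)` to `(k, 0)` and an error `O(1 / N)` from the pairs at the
boundary of the box (`norm_tsum_sub_average_le`). The choice `N ≈ min_j r_j^{1/4}` makes both at most
a constant times `max_j r_j^{-1/4}`.
-/

noncomputable section

namespace MicrolocalLift

variable {d : ℕ} {Γ : Subgroup (G d)}

/-! ### Matrix coordinates on `Γ \ 𝒢` -/

/-- `2 × 2` real matrices, as plain functions so that they carry the sup norm. -/
abbrev Mat2 : Type := Fin 2 → Fin 2 → ℝ

/-- `GL⁺(2, ℝ)^d`, as an open set of tuples of matrices. -/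
def posDet (d : ℕ) : Set (Fin d → Mat2) := {A | ∀ j, 0 < (Matrix.of (A j)).det}

/-- The submersion `GL⁺(2, ℝ)^d → Γ \ 𝒢`. -/
def coord (Γ : Subgroup (G d)) (A : Fin d → Mat2) : Y Γ := proj Γ fun j => ofPosDet (A j)

/-- The product of two `2 × 2` matrices. -/
def mmul (A B : Mat2) : Mat2 := fun p q => A p 0 * B 0 q + A p 1 * B 1 q

theorem det_mmul (A B : Mat2) :
    (Matrix.of (mmul A B)).det = (Matrix.of A).det * (Matrix.of B).det := by
  simp only [Matrix.det_fin_two, Matrix.of_apply, mmul]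
  ring

theorem ofPosDet_mmul {A B : Mat2} (hA : 0 < (Matrix.of A).det) (hB : 0 < (Matrix.of B).det) :
    ofPosDet (mmul A B) = ofPosDet A * ofPosDet B := by
  have hAB : 0 < (Matrix.of (mmul A B)).det := by rw [det_mmul]; positivity
  rw [ofPosDet, ofPosDet, ofPosDet, dif_pos hA, dif_pos hB, dif_pos hAB]
  refine congrArg (QuotientGroup.mk : SL(2, ℝ) → PSL(2, ℝ)) ?_
  refine Matrix.SpecialLinearGroup.ext _ _ fun p q => ?_
  change _ = (((√(Matrix.of A).det)⁻¹ • Matrix.of A) * ((√(Matrix.of B).det)⁻¹ • Matrix.of B)) p q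
  simp only [Matrix.mul_apply, Matrix.smul_apply,
    Matrix.of_apply, Fin.sum_univ_two, smul_eq_mul, det_mmul, Real.sqrt_mul hA.le, mul_inv]
  simp only [mmul]
  ring

/-- The class in `PSL(2, ℝ)` of a matrix of determinant one. -/
def ofDetOne (A : Mat2) (h : (Matrix.of A).det = 1) : PSL(2, ℝ) :=
  QuotientGroup.mk (⟨Matrix.of A, h⟩ : SL(2, ℝ))

theorem ofPosDet_of_det_one {A : Mat2} (h : (Matrix.of A).det = 1) :
    ofPosDet A = ofDetOne A h := by
  have h' : 0 < (Matrix.of A).det := by rw [h]; exact one_pos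
  rw [ofPosDet, dif_pos h']
  refine congrArg (QuotientGroup.mk : SL(2, ℝ) → PSL(2, ℝ)) ?_
  refine Matrix.SpecialLinearGroup.ext _ _ fun p q => ?_
  simp [h]

theorem isOpen_posDet : IsOpen (posDet d) := by
  have : posDet d = ⋂ j, {A : Fin d → Mat2 | 0 < A j 0 0 * A j 1 1 - A j 0 1 * A j 1 0} := by
    ext A
    simp [posDet, Matrix.det_fin_two]
  rw [this]
  exact isOpen_iInter_of_finite fun j => isOpen_lt (by fun_prop) (by fun_prop)

theorem exists_coord_eq (y : Y Γ) : ∃ A ∈ posDet d, coord Γ A = y := by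
  induction y using Quotient.inductionOn' with
  | h g =>
    choose B hB using fun j => QuotientGroup.mk_surjective (g j)
    refine ⟨fun j => (B j).1, fun j => ?_, ?_⟩
    · have : (Matrix.of (B j).1).det = 1 := (B j).2
      rw [this]; exact one_pos
    · change proj Γ _ = proj Γ g
      congr 1
      funext j
      rw [ofPosDet_of_det_one (B j).2, ← hB j]
      rfl

theorem IsSmooth.contDiffAt {f : Y Γ → ℂ} (hf : IsSmooth f) {A : Fin d → Mat2}
    (hA : A ∈ posDet d) : ContDiffAt ℝ ∞ (fun A => f (coord Γ A)) A :=
  ContDiffOn.contDiffAt (s := posDet d) hf (isOpen_posDet.mem_nhds hA)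

theorem isSmooth_iff {f : Y Γ → ℂ} :
    IsSmooth f ↔ ContDiffOn ℝ ∞ (fun A => f (coord Γ A)) (posDet d) := Iff.rfl

theorem translate_proj (g h : G d) : translate Γ (proj Γ g) h = proj Γ (g * h) := rfl

theorem translate_translate (y : Y Γ) (g h : G d) :
    translate Γ (translate Γ y g) h = translate Γ y (g * h) := by
  induction y using Quotient.inductionOn' with
  | h a => exact congrArg (proj Γ) (mul_assoc a g h)

theorem translate_one (y : Y Γ) : translate Γ y 1 = y := by
  induction y using Quotient.inductionOn' with
  | h a => exact congrArg (proj Γ) (mul_one a)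

/-- The linear vector field `A ↦ (0, …, A_j M, …, 0)` on tuples of matrices, which generates
right translation by `exp (t M)` on the `j`-th factor. -/
def field (j : Fin d) (M : Mat2) : (Fin d → Mat2) →L[ℝ] (Fin d → Mat2) :=
  LinearMap.toContinuousLinearMap
    { toFun := fun A k => if k = j then mmul (A j) M else 0
      map_add' := fun A B => by
        ext k p q
        by_cases h : k = j <;> simp [h, mmul]; ring
      map_smul' := fun c A => by
        ext k p q
        by_cases h : k = j <;> simp [h, mmul]; ring }

theorem field_apply (j : Fin d) (M : Mat2) (A : Fin d → Mat2) (k : Fin d) :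
    field j M A k = if k = j then mmul (A j) M else 0 := rfl

/-- `e` is the one-parameter subgroup of `PSL(2, ℝ)` with infinitesimal generator `M`: it lifts to
a curve of matrices with velocity `M` at the identity. -/
structure IsOneParam (e : ℝ → PSL(2, ℝ)) (M : Mat2) : Prop where
  add : ∀ s t, e (s + t) = e s * e t
  exists_curve : ∃ B : ℝ → Mat2, (∀ t, 0 < (Matrix.of (B t)).det) ∧ (∀ t, e t = ofPosDet (B t)) ∧
    B 0 = ![![1, 0], ![0, 1]] ∧ HasDerivAt B M 0

/-- The generator of `K = {k_θ}`. -/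
def matW : Mat2 := ![![0, 1], ![-1, 0]]

/-- The generator of the diagonal subgroup. -/
def matH : Mat2 := ![![1, 0], ![0, -1]]

/-- The generator of the upper unipotent subgroup. -/
def matX : Mat2 := ![![0, 1], ![0, 0]]

theorem det_rotation (t : ℝ) :
    (Matrix.of (![![Real.cos t, Real.sin t], ![-Real.sin t, Real.cos t]] : Mat2)).det = 1 := by
  simp only [Matrix.det_fin_two, Matrix.of_apply]
  simp [← sq]

theorem det_diagonal (t : ℝ) :
    (Matrix.of (![![Real.exp t, 0], ![0, Real.exp (-t)]] : Mat2)).det = 1 := by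
  simp [Matrix.det_fin_two, ← Real.exp_add]

theorem det_unipotent (t : ℝ) : (Matrix.of (![![1, t], ![0, 1]] : Mat2)).det = 1 := by
  simp [Matrix.det_fin_two]

theorem expW_eq_ofPosDet (t : ℝ) :
    expW t = ofPosDet ![![Real.cos t, Real.sin t], ![-Real.sin t, Real.cos t]] :=
  (ofPosDet_of_det_one (det_rotation t)).symm

theorem expH_eq_ofPosDet (t : ℝ) : expH t = ofPosDet ![![Real.exp t, 0], ![0, Real.exp (-t)]] :=
  (ofPosDet_of_det_one (det_diagonal t)).symm

theorem expX_eq_ofPosDet (t : ℝ) : expX t = ofPosDet ![![1, t], ![0, 1]] :=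
  (ofPosDet_of_det_one (det_unipotent t)).symm

theorem hasDerivAt_mat2 {B : ℝ → Mat2} {M : Mat2} {t : ℝ}
    (h00 : HasDerivAt (fun t => B t 0 0) (M 0 0) t) (h01 : HasDerivAt (fun t => B t 0 1) (M 0 1) t)
    (h10 : HasDerivAt (fun t => B t 1 0) (M 1 0) t)
    (h11 : HasDerivAt (fun t => B t 1 1) (M 1 1) t) : HasDerivAt B M t := by
  rw [hasDerivAt_pi]
  intro p
  rw [hasDerivAt_pi]
  intro q
  fin_cases p <;> fin_cases q <;> assumption

theorem isOneParam_of_curve {e : ℝ → PSL(2, ℝ)} {M : Mat2} (B : ℝ → Mat2)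
    (hdet : ∀ t, (Matrix.of (B t)).det = 1)
    (he : ∀ t, e t = ofPosDet (B t))
    (hadd : ∀ s t, B (s + t) = mmul (B s) (B t))
    (hB0 : B 0 = ![![1, 0], ![0, 1]]) (hB : HasDerivAt B M 0) : IsOneParam e M := by
  have hpos : ∀ t, 0 < (Matrix.of (B t)).det := fun t => by rw [hdet]; exact one_pos
  refine ⟨fun s t => ?_, B, hpos, he, hB0, hB⟩
  rw [he, he, he, hadd, ofPosDet_mmul (hpos s) (hpos t)]

theorem isOneParam_expW : IsOneParam expW matW := by
  refine isOneParam_of_curve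
    (fun t => ![![Real.cos t, Real.sin t], ![-Real.sin t, Real.cos t]]) det_rotation
    expW_eq_ofPosDet (fun s t => ?_) ?_ ?_
  · ext p q
    fin_cases p <;> fin_cases q <;> simp [mmul, Real.cos_add, Real.sin_add] <;> ring
  · simp
  · refine hasDerivAt_mat2 ?_ ?_ ?_ ?_
    · simpa [matW] using Real.hasDerivAt_cos 0
    · simpa [matW] using Real.hasDerivAt_sin 0
    · simpa [matW] using (Real.hasDerivAt_sin 0).fun_neg
    · simpa [matW] using Real.hasDerivAt_cos 0

theorem isOneParam_expH : IsOneParam expH matH := by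
  refine isOneParam_of_curve
    (fun t => ![![Real.exp t, 0], ![0, Real.exp (-t)]]) det_diagonal
    expH_eq_ofPosDet (fun s t => ?_) ?_ ?_
  · ext p q
    fin_cases p <;> fin_cases q <;> simp [mmul, Real.exp_add, mul_comm]
  · simp
  · refine hasDerivAt_mat2 ?_ ?_ ?_ ?_
    · simpa [matH] using Real.hasDerivAt_exp 0
    · simpa [matH] using hasDerivAt_const (0 : ℝ) (0 : ℝ)
    · simpa [matH] using hasDerivAt_const (0 : ℝ) (0 : ℝ)
    · simpa [matH] using (hasDerivAt_neg (0 : ℝ)).exp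

theorem isOneParam_expX : IsOneParam expX matX := by
  refine isOneParam_of_curve
    (fun t => ![![1, t], ![0, 1]]) det_unipotent
    expX_eq_ofPosDet (fun s t => ?_) ?_ ?_
  · ext p q
    fin_cases p <;> fin_cases q <;> simp [mmul, add_comm]
  · simp
  · refine hasDerivAt_mat2 ?_ ?_ ?_ ?_
    · simpa [matX] using hasDerivAt_const (0 : ℝ) (1 : ℝ)
    · simpa [matX] using hasDerivAt_id' (0 : ℝ)
    · simpa [matX] using hasDerivAt_const (0 : ℝ) (0 : ℝ)
    · simpa [matX] using hasDerivAt_const (0 : ℝ) (1 : ℝ)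

/-! ### Left-invariant derivatives -/

theorem translate_coord {A : Fin d → Mat2} (hA : A ∈ posDet d) (j : Fin d) {B : Mat2}
    (hB : 0 < (Matrix.of B).det) :
    translate Γ (coord Γ A) (Pi.mulSingle j (ofPosDet B)) =
      coord Γ (Function.update A j (mmul (A j) B)) := by
  rw [coord, translate_proj, coord]
  congr 1
  ext k
  by_cases h : k = j
  · subst h
    simp [ofPosDet_mmul (hA k) hB]
  · simp [h]

variable {e : ℝ → PSL(2, ℝ)} {M : Mat2}

/-- In matrix coordinates, the derivative along a one-parameter group is the directional derivative
along the linear field of its generator. -/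
theorem IsOneParam.hasDerivAt_zero (he : IsOneParam e M) {f : Y Γ → ℂ} (hf : IsSmooth f)
    {A : Fin d → Mat2} (hA : A ∈ posDet d) (j : Fin d) :
    HasDerivAt (fun t => f (translate Γ (coord Γ A) (Pi.mulSingle j (e t))))
      (fderiv ℝ (fun A => f (coord Γ A)) A (field j M A)) 0 := by
  obtain ⟨B, hpos, heB, hB0, hB⟩ := he.exists_curve
  have hc : HasDerivAt (fun t => Function.update A j (mmul (A j) (B t))) (field j M A) 0 := by
    rw [hasDerivAt_pi]
    intro k
    rw [field_apply]
    by_cases h : k = j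
    · subst h
      simp only [Function.update_self, if_true]
      rw [hasDerivAt_pi]
      intro p
      rw [hasDerivAt_pi]
      intro q
      have h0 := hasDerivAt_pi.mp (hasDerivAt_pi.mp hB 0) q
      have h1 := hasDerivAt_pi.mp (hasDerivAt_pi.mp hB 1) q
      exact (h0.const_mul (A k p 0)).add (h1.const_mul (A k p 1))
    · simp only [Function.update_of_ne h, if_neg h]
      exact hasDerivAt_const _ _
  have h0 : Function.update A j (mmul (A j) (B 0)) = A := by
    rw [Function.update_eq_self_iff]
    ext p q
    rw [hB0]
    fin_cases q <;> simp [mmul]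
  have hF : HasFDerivAt (fun A => f (coord Γ A)) (fderiv ℝ (fun A => f (coord Γ A)) A)
      (Function.update A j (mmul (A j) (B 0))) := by
    rw [h0]
    exact ((hf.contDiffAt hA).differentiableAt (by simp)).hasFDerivAt
  refine (hF.comp_hasDerivAt (0 : ℝ) hc).congr_of_eventuallyEq (Eventually.of_forall fun t => ?_)
  simp only [heB, translate_coord hA j (hpos t)]
  rfl

theorem IsOneParam.lieDeriv_coord (he : IsOneParam e M) {f : Y Γ → ℂ} (hf : IsSmooth f)
    {A : Fin d → Mat2} (hA : A ∈ posDet d) (j : Fin d) :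
    lieDeriv e j f (coord Γ A) = fderiv ℝ (fun A => f (coord Γ A)) A (field j M A) :=
  (he.hasDerivAt_zero hf hA j).deriv

theorem IsOneParam.hasDerivAt (he : IsOneParam e M) {f : Y Γ → ℂ} (hf : IsSmooth f) (y : Y Γ)
    (j : Fin d) (t : ℝ) :
    HasDerivAt (fun t => f (translate Γ y (Pi.mulSingle j (e t))))
      (lieDeriv e j f (translate Γ y (Pi.mulSingle j (e t)))) t := by
  obtain ⟨A, hA, hAy⟩ := exists_coord_eq (translate Γ y (Pi.mulSingle j (e t)))
  rw [← hAy, he.lieDeriv_coord hf hA]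
  have h := he.hasDerivAt_zero hf hA j
  rw [hAy, ← sub_self t] at h
  refine (h.comp_sub_const t t).congr_of_eventuallyEq (Eventually.of_forall fun s => ?_)
  simp only
  rw [translate_translate, ← Pi.mulSingle_mul, ← he.add, add_sub_cancel]

theorem IsOneParam.lieDeriv_isSmooth (he : IsOneParam e M) {f : Y Γ → ℂ} (hf : IsSmooth f)
    (j : Fin d) : IsSmooth (lieDeriv e j f) := by
  rw [isSmooth_iff] at hf ⊢
  have h1 : ContDiffOn ℝ ∞ (fderiv ℝ fun A => f (coord Γ A)) (posDet d) :=
    hf.fderiv_of_isOpen isOpen_posDet (by simp)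
  refine (h1.clm_apply (field j M).contDiff.contDiffOn).congr fun A hA => ?_
  exact he.lieDeriv_coord hf hA j

variable {f g : Y Γ → ℂ}

theorem IsSmooth.add (hf : IsSmooth f) (hg : IsSmooth g) : IsSmooth fun y => f y + g y :=
  ContDiffOn.add hf hg

theorem IsSmooth.sub (hf : IsSmooth f) (hg : IsSmooth g) : IsSmooth fun y => f y - g y :=
  ContDiffOn.sub hf hg

theorem IsSmooth.mul (hf : IsSmooth f) (hg : IsSmooth g) : IsSmooth fun y => f y * g y :=
  ContDiffOn.mul hf hg

theorem isSmooth_const (c : ℂ) : IsSmooth fun _ : Y Γ => c := contDiffOn_const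

theorem IsSmooth.const_mul (hf : IsSmooth f) (c : ℂ) : IsSmooth fun y => c * f y :=
  (isSmooth_const c).mul hf

theorem IsSmooth.conj (hf : IsSmooth f) : IsSmooth fun y => conj (f y) :=
  (Complex.conjCLE.toContinuousLinearMap.contDiff (n := ∞)).comp_contDiffOn hf

theorem IsSmooth.sum {ι : Type*} (s : Finset ι) {f : ι → Y Γ → ℂ} (hf : ∀ i, IsSmooth (f i)) :
    IsSmooth fun y => ∑ i ∈ s, f i y :=
  ContDiffOn.sum (E := Fin d → Mat2) (t := posDet d) (f := fun i A => f i (coord Γ A))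
    fun i _ => hf i

theorem IsOneParam.lieDeriv_add (he : IsOneParam e M) (hf : IsSmooth f) (hg : IsSmooth g)
    (j : Fin d) (y : Y Γ) :
    lieDeriv e j (fun y => f y + g y) y = lieDeriv e j f y + lieDeriv e j g y := by
  obtain ⟨A, hA, rfl⟩ := exists_coord_eq y
  exact ((he.hasDerivAt_zero hf hA j).differentiableAt.hasDerivAt.add
    (he.hasDerivAt_zero hg hA j).differentiableAt.hasDerivAt).deriv

theorem IsOneParam.lieDeriv_mul (he : IsOneParam e M) (hf : IsSmooth f) (hg : IsSmooth g)
    (j : Fin d) (y : Y Γ) :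
    lieDeriv e j (fun y => f y * g y) y = lieDeriv e j f y * g y + f y * lieDeriv e j g y := by
  obtain ⟨A, hA, rfl⟩ := exists_coord_eq y
  have h0 : e 0 = 1 := by simpa using he.add 0 0
  have h := ((he.hasDerivAt_zero hf hA j).differentiableAt.hasDerivAt.mul
    (he.hasDerivAt_zero hg hA j).differentiableAt.hasDerivAt).deriv
  simp only [h0, Pi.mulSingle_one, translate_one] at h
  exact h

theorem lieDeriv_const (e : ℝ → PSL(2, ℝ)) (j : Fin d) (c : ℂ) (y : Y Γ) :
    lieDeriv e j (fun _ => c) y = 0 := by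
  simp [lieDeriv]

theorem IsOneParam.lieDeriv_const_mul (he : IsOneParam e M) (c : ℂ) (hf : IsSmooth f)
    (j : Fin d) (y : Y Γ) :
    lieDeriv e j (fun y => c * f y) y = c * lieDeriv e j f y := by
  rw [he.lieDeriv_mul (isSmooth_const c) hf, lieDeriv_const, zero_mul, zero_add]

theorem IsOneParam.lieDeriv_conj (he : IsOneParam e M) (hf : IsSmooth f) (j : Fin d) (y : Y Γ) :
    lieDeriv e j (fun y => conj (f y)) y = conj (lieDeriv e j f y) := by
  obtain ⟨A, hA, rfl⟩ := exists_coord_eq y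
  exact (Complex.conjCLE.toContinuousLinearMap.hasFDerivAt.comp_hasDerivAt (0 : ℝ)
    (he.hasDerivAt_zero hf hA j).differentiableAt.hasDerivAt).deriv

/-- The commutator of two left-invariant derivatives, in matrix coordinates: the symmetric second
derivatives cancel, and the bracket of two linear fields is linear. -/
theorem IsOneParam.lieDeriv_comm_coord {e' : ℝ → PSL(2, ℝ)} {M' : Mat2} (he : IsOneParam e M)
    (he' : IsOneParam e' M') (hf : IsSmooth f) (j k : Fin d) {A : Fin d → Mat2}
    (hA : A ∈ posDet d) :
    lieDeriv e j (lieDeriv e' k f) (coord Γ A) - lieDeriv e' k (lieDeriv e j f) (coord Γ A) =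
      fderiv ℝ (fun A => f (coord Γ A)) A
        (field k M' (field j M A) - field j M (field k M' A)) := by
  have key : ∀ {e e' : ℝ → PSL(2, ℝ)} {M M' : Mat2}, IsOneParam e M → IsOneParam e' M' →
      ∀ j k : Fin d, lieDeriv e j (lieDeriv e' k f) (coord Γ A) =
        fderiv ℝ (fderiv ℝ fun A => f (coord Γ A)) A (field j M A) (field k M' A) +
          fderiv ℝ (fun A => f (coord Γ A)) A (field k M' (field j M A)) := by
    intro e e' M M' he he' j k
    rw [he.lieDeriv_coord (he'.lieDeriv_isSmooth hf k) hA j]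
    have heq : (fun A => lieDeriv e' k f (coord Γ A)) =ᶠ[𝓝 A]
        fun A => fderiv ℝ (fun A => f (coord Γ A)) A (field k M' A) := by
      filter_upwards [isOpen_posDet.mem_nhds hA] with B hB
      exact he'.lieDeriv_coord hf hB k
    have hd : DifferentiableAt ℝ (fderiv ℝ fun A => f (coord Γ A)) A :=
      ((hf.contDiffAt hA).fderiv_right (m := 1) (WithTop.coe_le_coe.mpr le_top)).differentiableAt (by simp)
    rw [heq.fderiv_eq, fderiv_clm_apply hd (field k M').differentiableAt]
    simp [add_comm]
  have hsymm : IsSymmSndFDerivAt ℝ (fun A => f (coord Γ A)) A :=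
    (hf.contDiffAt hA).isSymmSndFDerivAt
    (by simp only [minSmoothness_of_isRCLikeNormedField]; exact WithTop.coe_le_coe.mpr le_top)
  rw [key he he' j k, key he' he k j, hsymm.eq, map_sub]
  ring

theorem IsOneParam.lieDeriv_comm_of_ne {e' : ℝ → PSL(2, ℝ)} {M' : Mat2} (he : IsOneParam e M)
    (he' : IsOneParam e' M') (hf : IsSmooth f) {j k : Fin d} (hjk : j ≠ k) (y : Y Γ) :
    lieDeriv e j (lieDeriv e' k f) y = lieDeriv e' k (lieDeriv e j f) y := by
  obtain ⟨A, hA, rfl⟩ := exists_coord_eq y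
  have h := he.lieDeriv_comm_coord he' hf j k hA
  have h0 : field k M' (field j M A) - field j M (field k M' A) = 0 := by
    ext i p q
    by_cases h1 : i = j <;> by_cases h2 : i = k <;> simp [field_apply, mmul, h1, h2, hjk, hjk.symm]
  rwa [h0, map_zero, sub_eq_zero] at h

theorem IsOneParam.lieDeriv_bracket {e₁ e₂ : ℝ → PSL(2, ℝ)} {M₁ M₂ : Mat2}
    (h₁ : IsOneParam e₁ M₁) (h₂ : IsOneParam e₂ M₂) (hf : IsSmooth f) (j : Fin d) (a b c : ℝ)
    (hbr : ∀ A : Mat2, mmul (mmul A M₁) M₂ - mmul (mmul A M₂) M₁ =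
      a • mmul A matH + b • mmul A matX + c • mmul A matW) (y : Y Γ) :
    lieDeriv e₁ j (lieDeriv e₂ j f) y = lieDeriv e₂ j (lieDeriv e₁ j f) y +
      (a * lieDeriv expH j f y + b * lieDeriv expX j f y + c * lieDeriv expW j f y) := by
  obtain ⟨A, hA, rfl⟩ := exists_coord_eq y
  have h := h₁.lieDeriv_comm_coord h₂ hf j j hA
  have h0 : field j M₂ (field j M₁ A) - field j M₁ (field j M₂ A) =
      a • field j matH A + b • field j matX A + c • field j matW A := by
    ext i p q
    by_cases hi : i = j
    · simpa [field_apply, hi] using congrFun (congrFun (hbr (A j)) p) q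
    · simp [field_apply, hi]
  rw [h0, map_add, map_add, map_smul, map_smul, map_smul, ← isOneParam_expH.lieDeriv_coord hf hA,
    ← isOneParam_expX.lieDeriv_coord hf hA, ← isOneParam_expW.lieDeriv_coord hf hA,
    sub_eq_iff_eq_add'] at h
  rw [h]
  simp

theorem lieDeriv_bracket_HX (hf : IsSmooth f) (j : Fin d) (y : Y Γ) :
    lieDeriv expH j (lieDeriv expX j f) y =
      lieDeriv expX j (lieDeriv expH j f) y + 2 * lieDeriv expX j f y := by
  rw [isOneParam_expH.lieDeriv_bracket isOneParam_expX hf j 0 2 0]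
  · simp
  · intro A
    ext p q
    fin_cases q <;> (simp [mmul, matH, matX]; try ring)

theorem lieDeriv_bracket_HW (hf : IsSmooth f) (j : Fin d) (y : Y Γ) :
    lieDeriv expH j (lieDeriv expW j f) y =
      lieDeriv expW j (lieDeriv expH j f) y + (4 * lieDeriv expX j f y - 2 * lieDeriv expW j f y) := by
  rw [isOneParam_expH.lieDeriv_bracket isOneParam_expW hf j 0 4 (-2)]
  · push_cast; ring
  · intro A
    ext p q
    fin_cases q <;> (simp [mmul, matH, matX, matW]; ring)

theorem lieDeriv_bracket_XW (hf : IsSmooth f) (j : Fin d) (y : Y Γ) :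
    lieDeriv expX j (lieDeriv expW j f) y =
      lieDeriv expW j (lieDeriv expX j f) y - lieDeriv expH j f y := by
  rw [isOneParam_expX.lieDeriv_bracket isOneParam_expW hf j (-1) 0 0]
  · push_cast; ring
  · intro A
    ext p q
    fin_cases q <;> simp [mmul, matH, matX, matW]

end MicrolocalLift

end

noncomputable section

namespace MicrolocalLift

variable {d : ℕ} {Γ : Subgroup (G d)}

/-! ### The invariant measure on `Γ \ 𝒢` -/

instance slLocallyCompactSpace : LocallyCompactSpace SL(2, ℝ) := by
  have : LocallyCompactSpace (Matrix (Fin 2) (Fin 2) ℝ) :=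
    inferInstanceAs (LocallyCompactSpace (Fin 2 → Fin 2 → ℝ))
  have hc : IsClosed {A : Matrix (Fin 2) (Fin 2) ℝ | A.det = 1} :=
    isClosed_eq (Continuous.matrix_det continuous_id) continuous_const
  exact hc.isClosedEmbedding_subtypeVal.locallyCompactSpace

theorem continuous_proj : Continuous (proj Γ) := continuous_quotient_mk'

theorem isOpenMap_proj : IsOpenMap (proj Γ) :=
  isOpenMap_quotient_mk'_mul (Γ := Γ) (T := G d)

theorem proj_surjective : Function.Surjective (proj Γ) := Quotient.mk''_surjective

theorem measurable_proj : Measurable (proj Γ) := measurable_quotient_mk''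

theorem proj_smul (γ : Γ) (g : G d) : proj Γ (γ • g) = proj Γ g :=
  Quotient.sound' ⟨γ, rfl⟩

theorem measurable_iff_comp_proj {β : Type*} [MeasurableSpace β] {f : Y Γ → β} :
    Measurable f ↔ Measurable (f ∘ proj Γ) := measurable_from_quotient

theorem IsSmooth.continuous {f : Y Γ → ℂ} (hf : IsSmooth f) : Continuous f := by
  have hq : IsOpenQuotientMap
      (Pi.map fun _ : Fin d => (QuotientGroup.mk : SL(2, ℝ) → PSL(2, ℝ))) :=
    .piMap fun _ => QuotientGroup.isOpenQuotientMap_mk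
  have hp : IsOpenQuotientMap (proj Γ) := ⟨proj_surjective, continuous_proj, isOpenMap_proj⟩
  rw [(hp.comp hq).isQuotientMap.continuous_iff]
  have hval : Continuous fun (B : Fin d → SL(2, ℝ)) (j : Fin d) => ((B j).1 : Mat2) :=
    continuous_pi fun j => continuous_subtype_val.comp (continuous_apply j)
  have hmem : ∀ B : Fin d → SL(2, ℝ), (fun j => ((B j).1 : Mat2)) ∈ posDet d := fun B j => by
    have : (Matrix.of (B j).1).det = 1 := (B j).2
    rw [this]; exact one_pos
  refine ((isSmooth_iff.mp hf).continuousOn.comp_continuous hval hmem).congr fun B => ?_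
  have : (fun j => ofPosDet (B j).1) =
      Pi.map (fun _ : Fin d => (QuotientGroup.mk : SL(2, ℝ) → PSL(2, ℝ))) B := by
    funext j
    exact ofPosDet_of_det_one (B j).2
  simp only [coord, this, Function.comp]

theorem IsSmooth.measurable {f : Y Γ → ℂ} (hf : IsSmooth f) : Measurable f :=
  measurable_iff_comp_proj.mpr (hf.continuous.comp continuous_proj).measurable

theorem IsSmooth.exists_bound [CompactSpace (Y Γ)] {f : Y Γ → ℂ} (hf : IsSmooth f) :
    ∃ C, 0 ≤ C ∧ ∀ y, ‖f y‖ ≤ C := by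
  obtain ⟨C, hC⟩ := isCompact_univ.exists_bound_of_continuousOn hf.continuous.continuousOn
  exact ⟨max C 0, le_max_right _ _, fun y => (hC y trivial).trans (le_max_left _ _)⟩

variable {μ : Measure (G d)}

theorem countable_of_discrete [DiscreteTopology Γ] : Countable Γ :=
  countable_of_Lindelof_of_discrete

theorem exists_quotientMeasure_eq [DiscreteTopology Γ] (μ : Measure (G d)) :
    ∃ D : Set (G d), IsFundamentalDomain Γ D μ ∧
      quotientMeasure Γ μ = (μ.restrict D).map (proj Γ) := by
  have h := exists_isFundamentalDomain Γ μ
  exact ⟨h.choose, h.choose_spec, by rw [quotientMeasure, dif_pos h]⟩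

theorem exists_isCompact_image_proj [CompactSpace (Y Γ)] :
    ∃ K : Set (G d), IsCompact K ∧ proj Γ '' K = Set.univ := by
  choose K hK hx using fun x : G d => exists_compact_mem_nhds x
  obtain ⟨t, ht⟩ := isCompact_univ.elim_finite_subcover (fun x : G d => proj Γ '' interior (K x))
    (fun x => isOpenMap_proj _ isOpen_interior) (by
      intro y _
      obtain ⟨x, rfl⟩ := proj_surjective y
      exact Set.mem_iUnion.mpr ⟨x, x, mem_interior_iff_mem_nhds.mpr (hx x), rfl⟩)
  refine ⟨⋃ x ∈ t, K x, t.isCompact_biUnion fun x _ => hK x, Set.eq_univ_of_univ_subset ?_⟩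
  refine ht.trans ?_
  rw [Set.image_iUnion₂]
  exact Set.iUnion₂_mono fun x _ => Set.image_mono interior_subset

open scoped Pointwise in
theorem isFiniteMeasure_quotientMeasure [DiscreteTopology Γ] [CompactSpace (Y Γ)]
    [μ.IsHaarMeasure] : IsFiniteMeasure (quotientMeasure Γ μ) := by
  have := countable_of_discrete (Γ := Γ)
  obtain ⟨D, hD, hν⟩ := exists_quotientMeasure_eq (Γ := Γ) μ
  obtain ⟨K, hK, hKu⟩ := exists_isCompact_image_proj (Γ := Γ)
  refine ⟨?_⟩
  rw [hν, Measure.map_apply measurable_proj MeasurableSet.univ, Set.preimage_univ,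
    Measure.restrict_apply_univ]
  refine lt_of_le_of_lt ?_ (hK.measure_lt_top (μ := μ))
  have hcov : D ⊆ ⋃ γ : Γ, γ • K ∩ D := by
    intro g hg
    obtain ⟨k, hk, hkg⟩ : proj Γ g ∈ proj Γ '' K := by rw [hKu]; trivial
    obtain ⟨γ, hγ⟩ := Quotient.exact' hkg.symm
    exact Set.mem_iUnion.mpr ⟨γ, ⟨k, hk, hγ⟩, hg⟩
  calc μ D ≤ μ (⋃ γ : Γ, γ • K ∩ D) := measure_mono hcov
    _ ≤ ∑' γ : Γ, μ (γ • K ∩ D) := measure_iUnion_le _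
    _ = μ K := (hD.measure_eq_tsum K).symm

theorem quotientMeasure_univ_ne_zero [DiscreteTopology Γ] [μ.IsHaarMeasure] :
    quotientMeasure Γ μ Set.univ ≠ 0 := by
  have := countable_of_discrete (Γ := Γ)
  obtain ⟨D, hD, hν⟩ := exists_quotientMeasure_eq (Γ := Γ) μ
  rw [hν, Measure.map_apply measurable_proj MeasurableSet.univ, Set.preimage_univ,
    Measure.restrict_apply_univ]
  exact hD.measure_ne_zero (NeZero.ne μ)

theorem measurable_translate (h : G d) : Measurable fun y : Y Γ => translate Γ y h :=
  measurable_iff_comp_proj.mpr (measurable_proj.comp (measurable_mul_const h))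

/-- Right translation multiplies a Haar measure of `𝒢`, hence also the measure of `Γ \ 𝒢`, by a
constant; as `Γ \ 𝒢` has finite volume, the constant is one. -/
theorem measurePreserving_translate [DiscreteTopology Γ] [CompactSpace (Y Γ)]
    [μ.IsHaarMeasure] (h : G d) :
    MeasurePreserving (fun y : Y Γ => translate Γ y h) (quotientMeasure Γ μ)
      (quotientMeasure Γ μ) := by
  have := countable_of_discrete (Γ := Γ)
  have := isFiniteMeasure_quotientMeasure (Γ := Γ) (μ := μ)
  obtain ⟨D, hD, hν⟩ := exists_quotientMeasure_eq (Γ := Γ) μ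
  obtain ⟨c, hc⟩ : ∃ c : NNReal, μ.map (· * h) = c • μ :=
    ⟨_, Measure.isMulLeftInvariant_eq_smul (μ.map (· * h)) μ⟩
  have hscale : ∀ S : Set (Y Γ), MeasurableSet S →
      quotientMeasure Γ μ ((fun y : Y Γ => translate Γ y h) ⁻¹' S) = c * quotientMeasure Γ μ S := by
    intro S hS
    have hP : MeasurableSet (proj Γ ⁻¹' S) := measurable_proj hS
    have hD' : IsFundamentalDomain Γ ((· * h⁻¹) ⁻¹' D) μ :=
      hD.preimage_of_equiv (quasiMeasurePreserving_mul_right μ h⁻¹) (e := id)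
        Function.bijective_id fun γ g => mul_assoc _ _ _
    rw [hν, Measure.map_apply measurable_proj (measurable_translate h hS),
      Measure.map_apply measurable_proj hS,
      Measure.restrict_apply (measurable_proj (measurable_translate h hS)),
      Measure.restrict_apply hP,
      hD.measure_set_eq hD' hP fun γ => by
        ext g
        simp only [Set.mem_preimage, proj_smul]]
    have hset : proj Γ ⁻¹' ((fun y : Y Γ => translate Γ y h) ⁻¹' S) ∩ D =
        (· * h) ⁻¹' (proj Γ ⁻¹' S ∩ (· * h⁻¹) ⁻¹' D) := by
      ext g
      simp [translate_proj]
    have hmap := (MeasurableEquiv.mulRight h).map_apply (μ := μ) (proj Γ ⁻¹' S ∩ (· * h⁻¹) ⁻¹' D)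
    rw [MeasurableEquiv.coe_mulRight, hc] at hmap
    rw [hset, ← hmap]
    rfl
  have hc1 : c = 1 := by
    have h1 := hscale Set.univ MeasurableSet.univ
    rw [Set.preimage_univ] at h1
    have h2 : (c : ENNReal) = 1 :=
      (ENNReal.mul_eq_right quotientMeasure_univ_ne_zero (measure_ne_top _ _)).mp h1.symm
    exact_mod_cast h2
  refine ⟨measurable_translate h, Measure.ext fun S hS => ?_⟩
  rw [Measure.map_apply (measurable_translate h) hS, hscale S hS, hc1, ENNReal.coe_one, one_mul]

theorem IsSmooth.aestronglyMeasurable {f : Y Γ → ℂ} (hf : IsSmooth f) (ν : Measure (Y Γ)) :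
    AEStronglyMeasurable f ν := hf.measurable.aestronglyMeasurable

theorem IsSmooth.integrable [DiscreteTopology Γ] [CompactSpace (Y Γ)] [μ.IsHaarMeasure]
    {f : Y Γ → ℂ} (hf : IsSmooth f) : Integrable f (quotientMeasure Γ μ) := by
  have := isFiniteMeasure_quotientMeasure (Γ := Γ) (μ := μ)
  obtain ⟨C, -, hC⟩ := hf.exists_bound
  exact .of_bound (hf.aestronglyMeasurable _) C (Eventually.of_forall hC)

/-- Left-invariant derivatives of smooth functions have integral zero. -/
theorem IsOneParam.integral_lieDeriv [DiscreteTopology Γ] [CompactSpace (Y Γ)] [μ.IsHaarMeasure]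
    {e : ℝ → PSL(2, ℝ)} {M : Mat2} (he : IsOneParam e M) {f : Y Γ → ℂ} (hf : IsSmooth f)
    (j : Fin d) : ∫ y, lieDeriv e j f y ∂(quotientMeasure Γ μ) = 0 := by
  have := isFiniteMeasure_quotientMeasure (Γ := Γ) (μ := μ)
  set ν := quotientMeasure Γ μ
  have hL := he.lieDeriv_isSmooth hf j
  obtain ⟨C, -, hC⟩ := hL.exists_bound
  have hm : ∀ {g : Y Γ → ℂ}, IsSmooth g → ∀ t : ℝ, AEStronglyMeasurable
      (fun y => g (translate Γ y (Pi.mulSingle j (e t)))) ν := fun hg t =>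
    (hg.measurable.comp (measurable_translate _)).aestronglyMeasurable
  have hconst : ∀ t : ℝ, ∫ y, f (translate Γ y (Pi.mulSingle j (e t))) ∂ν = ∫ y, f y ∂ν := by
    intro t
    have hmp := measurePreserving_translate (Γ := Γ) (μ := μ) (Pi.mulSingle j (e t))
    conv_rhs => rw [show ν = _ from hmp.map_eq.symm]
    exact (integral_map hmp.measurable.aemeasurable (hf.aestronglyMeasurable _)).symm
  have h0 : e 0 = 1 := by simpa using he.add 0 0
  have hd := (hasDerivAt_integral_of_dominated_loc_of_deriv_le (μ := ν) (x₀ := (0 : ℝ))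
    (F := fun t y => f (translate Γ y (Pi.mulSingle j (e t))))
    (F' := fun t y => lieDeriv e j f (translate Γ y (Pi.mulSingle j (e t))))
    (bound := fun _ => C) univ_mem (Eventually.of_forall fun t => hm hf t)
    (by simpa [h0, translate_one] using hf.integrable) (hm hL 0)
    (Eventually.of_forall fun y t _ => hC _) (integrable_const C)
    (Eventually.of_forall fun y t _ => he.hasDerivAt hf y j t)).2
  simp only [hconst, h0, Pi.mulSingle_one, translate_one] at hd
  exact hd.unique (hasDerivAt_const _ _)

end MicrolocalLift

end

noncomputable section

namespace MicrolocalLift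

variable {d : ℕ} {Γ : Subgroup (G d)}

/-! ### The complexified Lie algebra acting on smooth functions -/

/-- The action of `a H + b X + c W` in the complexified Lie algebra of the `j`-th factor. -/
def lieComb (a b c : ℂ) (j : Fin d) (f : Y Γ → ℂ) (y : Y Γ) : ℂ :=
  a * lieDeriv expH j f y + b * lieDeriv expX j f y + c * lieDeriv expW j f y

variable {f g : Y Γ → ℂ} {j k : Fin d}

theorem Eplus_eq_lieComb : Eplus j f = lieComb 1 (2 * Complex.I) (-Complex.I) j f := by
  funext y
  simp only [Eplus, lieComb]
  ring

theorem Eminus_eq_lieComb : Eminus j f = lieComb 1 (-2 * Complex.I) Complex.I j f := by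
  funext y
  simp only [Eminus, lieComb]
  ring

theorem lieDeriv_expW_eq_lieComb : lieDeriv expW j f = lieComb 0 0 1 j f := by
  funext y
  simp [lieComb]

theorem IsSmooth.lieComb (hf : IsSmooth f) (a b c : ℂ) (j : Fin d) :
    IsSmooth (lieComb a b c j f) :=
  (((isOneParam_expH.lieDeriv_isSmooth hf j).const_mul a).add
    ((isOneParam_expX.lieDeriv_isSmooth hf j).const_mul b)).add
    ((isOneParam_expW.lieDeriv_isSmooth hf j).const_mul c)

theorem IsSmooth.lieDeriv_expW (hf : IsSmooth f) (j : Fin d) : IsSmooth (lieDeriv expW j f) :=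
  isOneParam_expW.lieDeriv_isSmooth hf j

theorem IsSmooth.Eplus (hf : IsSmooth f) (j : Fin d) : IsSmooth (Eplus j f) := by
  rw [Eplus_eq_lieComb]
  exact hf.lieComb _ _ _ j

theorem IsSmooth.Eminus (hf : IsSmooth f) (j : Fin d) : IsSmooth (Eminus j f) := by
  rw [Eminus_eq_lieComb]
  exact hf.lieComb _ _ _ j

theorem IsOneParam.lieDeriv_lieComb {e : ℝ → PSL(2, ℝ)} {M : Mat2} (he : IsOneParam e M)
    (hf : IsSmooth f) (a b c : ℂ) (j k : Fin d) (y : Y Γ) :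
    lieDeriv e k (lieComb a b c j f) y = a * lieDeriv e k (lieDeriv expH j f) y +
      b * lieDeriv e k (lieDeriv expX j f) y + c * lieDeriv e k (lieDeriv expW j f) y := by
  have hH := isOneParam_expH.lieDeriv_isSmooth hf j
  have hX := isOneParam_expX.lieDeriv_isSmooth hf j
  have hW := isOneParam_expW.lieDeriv_isSmooth hf j
  unfold lieComb
  rw [he.lieDeriv_add ((hH.const_mul a).add (hX.const_mul b)) (hW.const_mul c),
    he.lieDeriv_add (hH.const_mul a) (hX.const_mul b), he.lieDeriv_const_mul _ hH,
    he.lieDeriv_const_mul _ hX, he.lieDeriv_const_mul _ hW]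

theorem lieComb_const_mul (hf : IsSmooth f) (a b c s : ℂ) (j : Fin d) (y : Y Γ) :
    lieComb a b c j (fun y => s * f y) y = s * lieComb a b c j f y := by
  simp only [lieComb, isOneParam_expH.lieDeriv_const_mul s hf,
    isOneParam_expX.lieDeriv_const_mul s hf, isOneParam_expW.lieDeriv_const_mul s hf]
  ring

theorem lieComb_mul (hf : IsSmooth f) (hg : IsSmooth g) (a b c : ℂ) (j : Fin d) (y : Y Γ) :
    lieComb a b c j (fun y => f y * g y) y =
      lieComb a b c j f y * g y + f y * lieComb a b c j g y := by
  simp only [lieComb, isOneParam_expH.lieDeriv_mul hf hg,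
    isOneParam_expX.lieDeriv_mul hf hg, isOneParam_expW.lieDeriv_mul hf hg]
  ring

theorem lieComb_const (a b c s : ℂ) (j : Fin d) (y : Y Γ) :
    lieComb a b c j (fun _ => s) y = 0 := by
  simp [lieComb, lieDeriv_const]

theorem lieComb_comm_of_ne (hf : IsSmooth f) (hjk : j ≠ k) (a b c a' b' c' : ℂ) (y : Y Γ) :
    lieComb a b c j (lieComb a' b' c' k f) y = lieComb a' b' c' k (lieComb a b c j f) y := by
  rw [lieComb, lieComb]
  simp only [isOneParam_expH.lieDeriv_lieComb hf, isOneParam_expX.lieDeriv_lieComb hf,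
    isOneParam_expW.lieDeriv_lieComb hf,
    isOneParam_expH.lieDeriv_comm_of_ne isOneParam_expH hf hjk,
    isOneParam_expH.lieDeriv_comm_of_ne isOneParam_expX hf hjk,
    isOneParam_expH.lieDeriv_comm_of_ne isOneParam_expW hf hjk,
    isOneParam_expX.lieDeriv_comm_of_ne isOneParam_expH hf hjk,
    isOneParam_expX.lieDeriv_comm_of_ne isOneParam_expX hf hjk,
    isOneParam_expX.lieDeriv_comm_of_ne isOneParam_expW hf hjk,
    isOneParam_expW.lieDeriv_comm_of_ne isOneParam_expH hf hjk,
    isOneParam_expW.lieDeriv_comm_of_ne isOneParam_expX hf hjk,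
    isOneParam_expW.lieDeriv_comm_of_ne isOneParam_expW hf hjk]
  ring

/-- The bracket of the complexified Lie algebra:
`[H, X] = 2 X`, `[H, W] = 4 X - 2 W`, `[X, W] = - H`. -/
theorem lieComb_bracket (hf : IsSmooth f) (j : Fin d) (a b c a' b' c' : ℂ) (y : Y Γ) :
    lieComb a b c j (lieComb a' b' c' j f) y = lieComb a' b' c' j (lieComb a b c j f) y +
      lieComb (c * b' - b * c') (2 * (a * b' - b * a') + 4 * (a * c' - c * a'))
        (-2 * (a * c' - c * a')) j f y := by
  rw [lieComb, lieComb, lieComb]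
  simp only [isOneParam_expH.lieDeriv_lieComb hf, isOneParam_expX.lieDeriv_lieComb hf,
    isOneParam_expW.lieDeriv_lieComb hf, lieDeriv_bracket_HX hf, lieDeriv_bracket_HW hf,
    lieDeriv_bracket_XW hf]
  ring

/-- `[W, E⁺] = 2 i E⁺`. -/
theorem lieDeriv_expW_Eplus (hf : IsSmooth f) (j : Fin d) (y : Y Γ) :
    lieDeriv expW j (Eplus j f) y =
      Eplus j (lieDeriv expW j f) y + 2 * Complex.I * Eplus j f y := by
  simp only [Eplus_eq_lieComb, lieDeriv_expW_eq_lieComb]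
  rw [lieComb_bracket hf]
  simp only [lieComb]
  linear_combination (2 * lieDeriv expW j f y - 4 * lieDeriv expX j f y) * Complex.I_sq

/-- `[W, E⁻] = - 2 i E⁻`. -/
theorem lieDeriv_expW_Eminus (hf : IsSmooth f) (j : Fin d) (y : Y Γ) :
    lieDeriv expW j (Eminus j f) y =
      Eminus j (lieDeriv expW j f) y - 2 * Complex.I * Eminus j f y := by
  simp only [Eminus_eq_lieComb, lieDeriv_expW_eq_lieComb]
  rw [lieComb_bracket hf]
  simp only [lieComb]
  linear_combination (2 * lieDeriv expW j f y - 4 * lieDeriv expX j f y) * Complex.I_sq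

/-- `[E⁻, E⁺] = 4 i W`. -/
theorem Eminus_Eplus (hf : IsSmooth f) (j : Fin d) (y : Y Γ) :
    Eminus j (Eplus j f) y = Eplus j (Eminus j f) y + 4 * Complex.I * lieDeriv expW j f y := by
  simp only [Eplus_eq_lieComb, Eminus_eq_lieComb]
  rw [lieComb_bracket hf]
  simp only [lieComb]
  ring

/-! ### The eigenvalue equation on `Γ \ 𝒢` -/

theorem coe_ofPosDet_smul_I {A : Mat2} (hA : 0 < (Matrix.of A).det) :
    ((ofPosDet A • UpperHalfPlane.I : ℍ) : ℂ) =
      (A 0 0 * Complex.I + A 0 1) / (A 1 0 * Complex.I + A 1 1) := by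
  rw [ofPosDet, dif_pos hA]
  have hs : ((√(Matrix.of A).det : ℝ) : ℂ) ≠ 0 :=
    Complex.ofReal_ne_zero.mpr (Real.sqrt_pos.mpr hA).ne'
  set B : SL(2, ℝ) := ⟨(√(Matrix.of A).det)⁻¹ • Matrix.of A, by
    rw [Matrix.det_smul, Fintype.card_fin, inv_pow, Real.sq_sqrt hA.le, inv_mul_cancel₀ hA.ne']⟩
    with hB
  have hBe : ∀ p q, B p q = (√(Matrix.of A).det)⁻¹ * A p q := fun p q => rfl
  change ((B • UpperHalfPlane.I : ℍ) : ℂ) = _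
  rw [UpperHalfPlane.coe_specialLinearGroup_apply]
  simp only [hBe, UpperHalfPlane.coe_I]
  simp only [map_mul, map_inv₀, Algebra.algebraMap_self, RingHom.id_apply, Complex.ofReal_mul,
    Complex.ofReal_inv]
  rw [mul_assoc, mul_assoc, ← mul_add, ← mul_add, mul_div_mul_left _ _ (inv_ne_zero hs)]

theorem denom_ne_zero {A : Mat2} (hA : 0 < (Matrix.of A).det) :
    (A 1 0 * Complex.I + A 1 1 : ℂ) ≠ 0 := by
  intro h
  have h1 := congrArg Complex.re h
  have h2 := congrArg Complex.im h
  simp at h1 h2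
  rw [Matrix.det_fin_two] at hA
  simp [h1, h2] at hA

variable {μ : Measure (G d)}

/-- The function `φ_0(Γ g) = φ(g(i))` on `Γ \ 𝒢`. -/
abbrev LaplaceEigenfunction.base (φ : LaplaceEigenfunction Γ μ) : Y Γ → ℂ :=
  pullback φ.toFun φ.invariant

theorem base_proj (φ : LaplaceEigenfunction Γ μ) (g : G d) :
    φ.base (proj Γ g) = φ.toFun fun j => g j • UpperHalfPlane.I := rfl

theorem LaplaceEigenfunction.isSmooth_base (φ : LaplaceEigenfunction Γ μ) : IsSmooth φ.base := by
  rw [isSmooth_iff]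
  have hw : ContDiffOn ℝ ∞ (fun (A : Fin d → Mat2) (j : Fin d) =>
      ((A j 0 0 : ℂ) * Complex.I + A j 0 1) * ((A j 1 0 : ℂ) * Complex.I + A j 1 1)⁻¹)
      (posDet d) := by
    have hcoe : ∀ (j : Fin d) (p q : Fin 2),
        ContDiff ℝ ∞ fun A : Fin d → Mat2 => ((A j p q : ℝ) : ℂ) := fun j p q =>
      Complex.ofRealCLM.contDiff.comp (by fun_prop : ContDiff ℝ ∞ fun A : Fin d → Mat2 => A j p q)
    refine contDiffOn_pi.mpr fun j => ?_
    refine (((hcoe j 0 0).mul contDiff_const).add (hcoe j 0 1)).contDiffOn.mul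
      ((((hcoe j 1 0).mul contDiff_const).add (hcoe j 1 1)).contDiffOn.inv fun A hA => ?_)
    exact denom_ne_zero (hA j)
  have hval : ∀ A ∈ posDet d, ∀ j : Fin d,
      ((A j 0 0 : ℂ) * Complex.I + A j 0 1) * ((A j 1 0 : ℂ) * Complex.I + A j 1 1)⁻¹ =
        ((ofPosDet (A j) • UpperHalfPlane.I : ℍ) : ℂ) := fun A hA j => by
    rw [coe_ofPosDet_smul_I (hA j), div_eq_mul_inv]
  refine (φ.smooth.comp hw fun A hA j => ?_).congr fun A hA => ?_
  · rw [hval A hA j]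
    exact UpperHalfPlane.im_pos _
  · rw [coord, base_proj]
    refine congrArg φ.toFun (funext fun j => ?_)
    simp only [hval A hA j, UpperHalfPlane.ofComplex_apply]

theorem expW_smul_I (θ : ℝ) : expW θ • UpperHalfPlane.I = UpperHalfPlane.I := by
  have hpos : 0 < (Matrix.of (![![Real.cos θ, Real.sin θ], ![-Real.sin θ, Real.cos θ]] : Mat2)).det
    := by rw [det_rotation]; exact one_pos
  ext
  have hne := denom_ne_zero hpos
  rw [expW_eq_ofPosDet, coe_ofPosDet_smul_I hpos, div_eq_iff hne]
  simp
  linear_combination (Complex.sin θ) * Complex.I_sq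

theorem LaplaceEigenfunction.base_translate_expW (φ : LaplaceEigenfunction Γ μ) (y : Y Γ)
    (j : Fin d) (θ : ℝ) : φ.base (translate Γ y (Pi.mulSingle j (expW θ))) = φ.base y := by
  obtain ⟨g, rfl⟩ := proj_surjective y
  rw [translate_proj, base_proj, base_proj]
  refine congrArg φ.toFun (funext fun k => ?_)
  by_cases h : k = j
  · subst h
    rw [Pi.mul_apply, Pi.mulSingle_eq_same, mul_smul, expW_smul_I]
  · rw [Pi.mul_apply, Pi.mulSingle_eq_of_ne h, mul_one]

theorem LaplaceEigenfunction.lieDeriv_expW_base (φ : LaplaceEigenfunction Γ μ) (j : Fin d)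
    (y : Y Γ) : lieDeriv expW j φ.base y = 0 := by
  simp only [lieDeriv, φ.base_translate_expW, deriv_const]

/-- On right `K_j`-invariant functions `E⁻ E⁺` is `H² - 2H + 4X²`, in which `W` no longer occurs. -/
theorem Eminus_Eplus_of_invariant (hf : IsSmooth f) (j : Fin d)
    (hW : ∀ y, lieDeriv expW j f y = 0) (y : Y Γ) :
    Eminus j (Eplus j f) y = lieDeriv expH j (lieDeriv expH j f) y - 2 * lieDeriv expH j f y +
      4 * lieDeriv expX j (lieDeriv expX j f) y := by
  have hW' : lieDeriv expW j f = fun _ => 0 := funext hW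
  rw [Eminus_eq_lieComb, Eplus_eq_lieComb, lieComb]
  have h1 := lieDeriv_bracket_HW hf j y
  have h2 := lieDeriv_bracket_XW hf j y
  simp only [isOneParam_expH.lieDeriv_lieComb hf, isOneParam_expX.lieDeriv_lieComb hf,
    isOneParam_expW.lieDeriv_lieComb hf, lieDeriv_bracket_HX hf, hW', lieDeriv_const] at h1 h2 ⊢
  linear_combination (-4 * lieDeriv expX j (lieDeriv expX j f) y +
    2 * lieDeriv expW j (lieDeriv expX j f) y) * Complex.I_sq - Complex.I * h1 + 2 * h2

theorem IsOneParam.lieDeriv_lieDeriv {e : ℝ → PSL(2, ℝ)} {M : Mat2} (he : IsOneParam e M)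
    (hf : IsSmooth f) (j : Fin d) (y : Y Γ) : lieDeriv e j (lieDeriv e j f) y =
      deriv (deriv fun t => f (translate Γ y (Pi.mulSingle j (e t)))) 0 := by
  rw [lieDeriv]
  congr 1
  funext t
  exact (he.hasDerivAt hf y j t).deriv.symm

/-- The Iwasawa decomposition in `PSL(2, ℝ)`. -/
theorem exists_upper_mul_expW (g : PSL(2, ℝ)) : ∃ α β δ θ : ℝ, 0 < α ∧ 0 < δ ∧
    g = ofPosDet ![![α, β], ![0, δ]] * expW θ := by
  obtain ⟨B, rfl⟩ := QuotientGroup.mk_surjective g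
  have hdet : B 0 0 * B 1 1 - B 0 1 * B 1 0 = 1 := by
    rw [← Matrix.det_fin_two]; exact B.2
  have hpos : 0 < B 1 0 ^ 2 + B 1 1 ^ 2 := by
    by_contra h
    have h1 : B 1 0 = 0 := by nlinarith [sq_nonneg (B 1 0), sq_nonneg (B 1 1)]
    have h2 : B 1 1 = 0 := by nlinarith [sq_nonneg (B 1 0), sq_nonneg (B 1 1)]
    rw [h1, h2] at hdet
    simp at hdet
  set ρ := √(B 1 0 ^ 2 + B 1 1 ^ 2) with hρ
  have hρ0 : 0 < ρ := Real.sqrt_pos.mpr hpos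
  have hρ2 : ρ ^ 2 = B 1 0 ^ 2 + B 1 1 ^ 2 := Real.sq_sqrt hpos.le
  obtain ⟨θ, hcos, hsin⟩ : ∃ θ : ℝ, Real.cos θ = B 1 1 / ρ ∧ Real.sin θ = -B 1 0 / ρ := by
    have hn : ‖(⟨B 1 1 / ρ, -B 1 0 / ρ⟩ : ℂ)‖ = 1 := by
      rw [← sq_eq_sq₀ (norm_nonneg _) zero_le_one, ← Complex.normSq_eq_norm_sq,
        Complex.normSq_mk]
      field_simp
      linarith
    obtain ⟨θ, hθ⟩ := (Complex.norm_eq_one_iff _).mp hn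
    refine ⟨θ, ?_, ?_⟩
    · simpa [Complex.exp_ofReal_mul_I_re] using congrArg Complex.re hθ
    · simpa [Complex.exp_ofReal_mul_I_im] using congrArg Complex.im hθ
  refine ⟨1 / ρ, (B 0 0 * B 1 0 + B 0 1 * B 1 1) / ρ, ρ, θ, by positivity, hρ0, ?_⟩
  have h1 : (Matrix.of (![![1 / ρ, (B 0 0 * B 1 0 + B 0 1 * B 1 1) / ρ], ![0, ρ]] : Mat2)).det
      = 1 := by
    simp [Matrix.det_fin_two, hρ0.ne']
  have hB : (QuotientGroup.mk B : PSL(2, ℝ)) = ofPosDet B.1 := (ofPosDet_of_det_one B.2).symm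
  rw [hB, expW_eq_ofPosDet,
    ← ofPosDet_mmul (by rw [h1]; exact one_pos) (by rw [det_rotation]; exact one_pos)]
  congr 1
  ext p q
  rw [hcos, hsin]
  fin_cases p <;> fin_cases q <;> simp [mmul] <;> field_simp
  · rw [hρ2]; linear_combination (B 1 1) * hdet
  · rw [hρ2]; linear_combination (-B 1 0) * hdet

theorem LaplaceEigenfunction.contDiffAt_update (φ : LaplaceEigenfunction Γ μ) (z : Fin d → ℍ)
    (j : Fin d) {w : ℝ → ℂ} {t : ℝ} (hw : ContDiffAt ℝ ∞ w t) (hpos : 0 < (w t).im) :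
    ContDiffAt ℝ ∞
      (fun t => φ.toFun (Function.update z j (UpperHalfPlane.ofComplex (w t)))) t := by
  have hopen : IsOpen {w : Fin d → ℂ | ∀ j, 0 < (w j).im} := by
    simp only [Set.ofPred_forall]
    exact isOpen_iInter_of_finite fun j =>
      isOpen_lt continuous_const (Complex.continuous_im.comp (continuous_apply j))
  have hmem : Function.update (fun k => (z k : ℂ)) j (w t) ∈
      {w : Fin d → ℂ | ∀ j, 0 < (w j).im} := by
    intro k
    by_cases h : k = j
    · subst h; simpa using hpos
    · simpa [h] using (z k).im_pos
  have h1 := φ.smooth.contDiffAt (hopen.mem_nhds hmem)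
  have h2 : ContDiffAt ℝ ∞ (fun t => Function.update (fun k => (z k : ℂ)) j (w t)) t := by
    refine contDiffAt_pi.mpr fun k => ?_
    by_cases h : k = j
    · subst h; simpa using hw
    · simpa [h] using contDiffAt_const
  refine (h1.comp t h2).congr_of_eventuallyEq (Eventually.of_forall fun s => ?_)
  refine congrArg φ.toFun (funext fun k => ?_)
  by_cases h : k = j
  · subst h; simp
  · simp [h, UpperHalfPlane.ofComplex_apply]

theorem LaplaceEigenfunction.base_translate_upper (φ : LaplaceEigenfunction Γ μ) {g : G d}
    {j : Fin d} {e : PSL(2, ℝ)} {A : Mat2} (hA : 0 < (Matrix.of A).det) (hg : g j * e = ofPosDet A) :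
    φ.base (translate Γ (proj Γ g) (Pi.mulSingle j e)) =
      φ.toFun (Function.update (fun k => g k • UpperHalfPlane.I) j (UpperHalfPlane.ofComplex
        ((A 0 0 * Complex.I + A 0 1) / (A 1 0 * Complex.I + A 1 1)))) := by
  rw [translate_proj, base_proj]
  refine congrArg φ.toFun (funext fun k => ?_)
  by_cases h : k = j
  · subst h
    rw [Pi.mul_apply, Pi.mulSingle_eq_same, hg, ← coe_ofPosDet_smul_I hA,
      UpperHalfPlane.ofComplex_apply, Function.update_self]
  · rw [Pi.mul_apply, Pi.mulSingle_eq_of_ne h, mul_one, Function.update_of_ne h]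

/-- At a point whose `j`-th component is upper triangular, `H² - 2H` is `4 y² ∂²/∂y²` and
`X²` is `y² ∂²/∂x²`. -/
theorem LaplaceEigenfunction.Eminus_Eplus_base_upper (φ : LaplaceEigenfunction Γ μ) {g : G d}
    {j : Fin d} {α β δ : ℝ} (hα : 0 < α) (hδ : 0 < δ) (hg : g j = ofPosDet ![![α, β], ![0, δ]]) :
    Eminus j (Eplus j φ.base) (proj Γ g) + (1 + 4 * φ.r j ^ 2) * φ.base (proj Γ g) = 0 := by
  set z : Fin d → ℍ := fun k => g k • UpperHalfPlane.I with hz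
  have hδ' : (δ : ℂ) ≠ 0 := Complex.ofReal_ne_zero.mpr hδ.ne'
  have hdetA : 0 < (Matrix.of (![![α, β], ![0, δ]] : Mat2)).det := by
    simp [Matrix.det_fin_two]; positivity
  have hzj : ((z j : ℍ) : ℂ) = β / δ + (α / δ) * Complex.I := by
    rw [hz]
    simp only [hg]
    rw [coe_ofPosDet_smul_I hdetA]
    simp
    field_simp
    ring
  set x : ℝ := β / δ with hx
  set y : ℝ := α / δ with hy
  have hy0 : 0 < y := by positivity
  have hre : (z j).re = x := by
    have := congrArg Complex.re hzj
    simpa [← Complex.ofReal_div] using this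
  have him : (z j).im = y := by
    have := congrArg Complex.im hzj
    simpa [← Complex.ofReal_div] using this
  set p : ℝ → ℂ := fun s => φ.toFun (Function.update z j
    (UpperHalfPlane.ofComplex (s + y * Complex.I))) with hp
  set q : ℝ → ℂ := fun s => φ.toFun (Function.update z j
    (UpperHalfPlane.ofComplex (x + s * Complex.I))) with hq
  have hps : ∀ s, ContDiffAt ℝ ∞ p s := fun s => by
    refine φ.contDiffAt_update z j (ContDiffAt.add ?_ contDiffAt_const) ?_
    · exact Complex.ofRealCLM.contDiff.contDiffAt
    · simpa using hy0
  have hqs : ∀ s, 0 < s → ContDiffAt ℝ ∞ q s := fun s hs => by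
    refine φ.contDiffAt_update z j (contDiffAt_const.add (ContDiffAt.mul ?_ contDiffAt_const)) ?_
    · exact Complex.ofRealCLM.contDiff.contDiffAt
    · simpa using hs
  -- right translation by `exp (tX)` and `exp (tH)` moves `z_j` horizontally and vertically
  have hX : (fun t : ℝ => φ.base (translate Γ (proj Γ g) (Pi.mulSingle j (expX t)))) =
      fun t => p (x + y * t) := by
    funext t
    have h1' : 0 < (Matrix.of (![![1, t], ![0, 1]] : Mat2)).det := by
      rw [det_unipotent]; exact one_pos
    rw [φ.base_translate_upper (A := mmul ![![α, β], ![0, δ]] ![![1, t], ![0, 1]])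
      (by rw [det_mmul]; positivity) (by rw [hg, expX_eq_ofPosDet, ofPosDet_mmul hdetA h1'])]
    rw [hp]
    congr 3
    simp [mmul, hx, hy]
    field_simp
    ring
  have hH : (fun t : ℝ => φ.base (translate Γ (proj Γ g) (Pi.mulSingle j (expH t)))) =
      fun t => q (y * Real.exp (2 * t)) := by
    funext t
    have h1' : 0 < (Matrix.of (![![Real.exp t, 0], ![0, Real.exp (-t)]] : Mat2)).det := by
      rw [det_diagonal]; exact one_pos
    rw [φ.base_translate_upper
      (A := mmul ![![α, β], ![0, δ]] ![![Real.exp t, 0], ![0, Real.exp (-t)]])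
      (by rw [det_mmul]; positivity) (by rw [hg, expH_eq_ofPosDet, ofPosDet_mmul hdetA h1'])]
    rw [hq]
    congr 3
    have h2 : Complex.exp (2 * t) = Complex.exp t * Complex.exp t := by
      rw [← Complex.exp_add]; ring_nf
    have h3 := Complex.exp_ne_zero (t : ℂ)
    simp [mmul, hx, hy, h2, Complex.exp_neg]
    field_simp
    exact add_comm _ _
  have hdq : ∀ t, 0 < y * Real.exp (2 * t) := fun t => by positivity
  have hinner : ∀ t, HasDerivAt (fun t => y * Real.exp (2 * t)) (2 * (y * Real.exp (2 * t))) t := by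
    intro t
    have := ((hasDerivAt_id t).const_mul 2).exp.const_mul y
    simp only [id, mul_one] at this
    exact this.congr_deriv (by ring)
  have hd1 : deriv (fun t => q (y * Real.exp (2 * t))) =
      fun t => (2 * (y * Real.exp (2 * t))) • deriv q (y * Real.exp (2 * t)) := by
    funext t
    exact (HasDerivAt.scomp t
      ((hqs _ (hdq t)).differentiableAt (by simp)).hasDerivAt (hinner t)).deriv
  have hdd : ∀ {f : ℝ → ℂ} {s : ℝ}, ContDiffAt ℝ ∞ f s → DifferentiableAt ℝ (deriv f) s := by
    intro f s hf
    have h1 : DifferentiableAt ℝ (fderiv ℝ f) s :=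
      (hf.fderiv_right (m := 1) (WithTop.coe_le_coe.mpr le_top)).differentiableAt (by simp)
    have h2 : deriv f = fun t => fderiv ℝ f t 1 := funext fun t => fderiv_apply_one_eq_deriv.symm
    rw [h2]
    exact h1.clm_apply (differentiableAt_const _)
  -- `(H² - 2H) u = (4 y q' + 4 y² q'') - 4 y q'`, with `q` the function `u` on the vertical line
  have hHu : lieDeriv expH j φ.base (proj Γ g) = 2 * y * deriv q y := by
    rw [lieDeriv, hH, hd1]
    simp
  have hHHu : lieDeriv expH j (lieDeriv expH j φ.base) (proj Γ g) =
      4 * y * deriv q y + 4 * y ^ 2 * deriv (deriv q) y := by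
    rw [isOneParam_expH.lieDeriv_lieDeriv φ.isSmooth_base, hH, hd1]
    have h1 := HasDerivAt.scomp (0 : ℝ) (hdd (hqs (y * Real.exp (2 * 0)) (hdq 0))).hasDerivAt
      (hinner 0)
    have h2 := ((hinner 0).const_mul 2).smul h1
    refine h2.deriv.trans ?_
    simp
    ring
  have hXXu : lieDeriv expX j (lieDeriv expX j φ.base) (proj Γ g) =
      y ^ 2 * deriv (deriv p) x := by
    rw [isOneParam_expX.lieDeriv_lieDeriv φ.isSmooth_base, hX]
    have hin : ∀ t : ℝ, HasDerivAt (fun t : ℝ => x + y * t) y t := fun t => by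
      simpa using ((hasDerivAt_id t).const_mul y).const_add x
    have h1 : deriv (fun t => p (x + y * t)) = fun t => y • deriv p (x + y * t) := by
      funext t
      exact (HasDerivAt.scomp t ((hps _).differentiableAt (by simp)).hasDerivAt (hin t)).deriv
    rw [h1]
    have h2 := (HasDerivAt.scomp (0 : ℝ) (hdd (hps (x + y * 0))).hasDerivAt (hin 0)).const_smul y
    refine h2.deriv.trans ?_
    simp
    ring
  have heig := φ.eigen j z
  rw [partialLaplacian, hre, him] at heig
  simp only [iteratedDeriv_succ, iteratedDeriv_zero] at heig
  rw [Eminus_Eplus_of_invariant φ.isSmooth_base j (φ.lieDeriv_expW_base j), hHu, hHHu, hXXu]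
  have hb : φ.base (proj Γ g) = φ.toFun z := rfl
  rw [hb]
  linear_combination 4 * heig

/-- The eigenvalue equation `E⁻ E⁺ φ₀ = 4 Δ φ₀ = -(1 + 4 r²) φ₀` on `Γ \ 𝒢`. Both sides are
invariant under `K_j`, so by the Iwasawa decomposition it is enough to compare them at upper
triangular elements. -/
theorem LaplaceEigenfunction.Eminus_Eplus_base (φ : LaplaceEigenfunction Γ μ) (j : Fin d)
    (y : Y Γ) : Eminus j (Eplus j φ.base) y = -(1 + 4 * φ.r j ^ 2) * φ.base y := by
  set ψ : Y Γ → ℂ := fun y => Eminus j (Eplus j φ.base) y + (1 + 4 * φ.r j ^ 2) * φ.base y with hψ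
  have hs := φ.isSmooth_base
  have hsE := (hs.Eplus j).Eminus j
  have hW0 : lieDeriv expW j φ.base = fun _ => 0 := funext (φ.lieDeriv_expW_base j)
  have hWE : lieDeriv expW j (Eplus j φ.base) = fun y => 2 * Complex.I * Eplus j φ.base y := by
    funext y
    rw [lieDeriv_expW_Eplus hs, hW0, Eplus_eq_lieComb, lieComb_const, zero_add]
  have hψs : IsSmooth ψ := hsE.add (hs.const_mul _)
  have hWψ : ∀ y, lieDeriv expW j ψ y = 0 := by
    intro y
    rw [hψ, isOneParam_expW.lieDeriv_add hsE (hs.const_mul _),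
      isOneParam_expW.lieDeriv_const_mul _ hs, hW0, lieDeriv_expW_Eminus (hs.Eplus j), hWE]
    simp only [Eminus_eq_lieComb, lieComb_const_mul (hs.Eplus j)]
    ring
  have hinv : ∀ (y : Y Γ) (θ : ℝ), ψ (translate Γ y (Pi.mulSingle j (expW θ))) = ψ y := by
    intro y θ
    have hd := fun t => isOneParam_expW.hasDerivAt hψs y j t
    simp only [hWψ] at hd
    have h := is_const_of_deriv_eq_zero (fun t => (hd t).differentiableAt)
      (fun t => (hd t).deriv) θ 0
    have h0 : expW 0 = 1 := by simpa using isOneParam_expW.add 0 0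
    simpa [h0, translate_one] using h
  have hzero : ψ y = 0 := by
    obtain ⟨g, rfl⟩ := proj_surjective y
    obtain ⟨α, β, δ, θ, hα, hδ, hg⟩ := exists_upper_mul_expW (g j)
    have h1 : proj Γ g = translate Γ (proj Γ (g * Pi.mulSingle j (expW θ)⁻¹))
        (Pi.mulSingle j (expW θ)) := by
      rw [translate_proj, mul_assoc, ← Pi.mulSingle_mul]
      simp
    rw [h1, hinv]
    refine φ.Eminus_Eplus_base_upper hα hδ (β := β) ?_
    rw [Pi.mul_apply, Pi.mulSingle_eq_same, hg, mul_inv_cancel_right]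
  linear_combination hzero

end MicrolocalLift

end

noncomputable section

namespace MicrolocalLift

variable {d : ℕ} {Γ : Subgroup (G d)} {f : Y Γ → ℂ} {j k : Fin d} {r : ℂ}

/-! ### Raising and lowering in one factor -/

theorem raise_succ (j : Fin d) (r : ℂ) (m : ℕ) (f : Y Γ → ℂ) :
    raise j r (m + 1) f =
      fun y => (2 * Complex.I * r + 1 + 2 * m)⁻¹ * Eplus j (raise j r m f) y := by
  funext y
  exact div_eq_inv_mul _ _

theorem lower_succ (j : Fin d) (r : ℂ) (m : ℕ) (f : Y Γ → ℂ) :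
    lower j r (m + 1) f =
      fun y => (2 * Complex.I * r + 1 + 2 * m)⁻¹ * Eminus j (lower j r m f) y := by
  funext y
  rw [lower]
  simp only [div_eq_inv_mul, mul_neg, sub_neg_eq_add]

theorem IsSmooth.raise (hf : IsSmooth f) (j : Fin d) (r : ℂ) (m : ℕ) :
    IsSmooth (raise j r m f) := by
  induction m with
  | zero => exact hf
  | succ m ih => rw [raise_succ]; exact (ih.Eplus j).const_mul _

theorem IsSmooth.lower (hf : IsSmooth f) (j : Fin d) (r : ℂ) (m : ℕ) :
    IsSmooth (lower j r m f) := by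
  induction m with
  | zero => exact hf
  | succ m ih => rw [lower_succ]; exact (ih.Eminus j).const_mul _

theorem IsSmooth.shift (hf : IsSmooth f) (j : Fin d) (r : ℂ) (n : ℤ) :
    IsSmooth (shift j r n f) := by
  rw [MicrolocalLift.shift]
  split_ifs
  · exact hf.raise _ _ _
  · exact hf.lower _ _ _

theorem Eplus_const_mul (hf : IsSmooth f) (j : Fin d) (c : ℂ) :
    Eplus j (fun y => c * f y) = fun y => c * Eplus j f y := by
  funext y
  rw [Eplus_eq_lieComb, Eplus_eq_lieComb, lieComb_const_mul hf]

theorem Eminus_const_mul (hf : IsSmooth f) (j : Fin d) (c : ℂ) :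
    Eminus j (fun y => c * f y) = fun y => c * Eminus j f y := by
  funext y
  rw [Eminus_eq_lieComb, Eminus_eq_lieComb, lieComb_const_mul hf]

theorem lieComb_raise_of_ne (hf : IsSmooth f) (hjk : j ≠ k) (a b c : ℂ) (m : ℕ) :
    lieComb a b c j (raise k r m f) = raise k r m (lieComb a b c j f) := by
  induction m with
  | zero => rfl
  | succ m ih =>
    funext y
    rw [raise_succ, raise_succ, lieComb_const_mul ((hf.raise k r m).Eplus k), ← ih,
      Eplus_eq_lieComb, Eplus_eq_lieComb, lieComb_comm_of_ne (hf.raise k r m) hjk]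

theorem lieComb_lower_of_ne (hf : IsSmooth f) (hjk : j ≠ k) (a b c : ℂ) (m : ℕ) :
    lieComb a b c j (lower k r m f) = lower k r m (lieComb a b c j f) := by
  induction m with
  | zero => rfl
  | succ m ih =>
    funext y
    rw [lower_succ, lower_succ, lieComb_const_mul ((hf.lower k r m).Eminus k), ← ih,
      Eminus_eq_lieComb, Eminus_eq_lieComb, lieComb_comm_of_ne (hf.lower k r m) hjk]

theorem lieComb_shift_of_ne (hf : IsSmooth f) (hjk : j ≠ k) (a b c : ℂ) (n : ℤ) :
    lieComb a b c j (shift k r n f) = shift k r n (lieComb a b c j f) := by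
  rw [shift, shift]
  split_ifs
  · exact lieComb_raise_of_ne hf hjk a b c _
  · exact lieComb_lower_of_ne hf hjk a b c _

theorem raise_const_mul (hf : IsSmooth f) (c : ℂ) (m : ℕ) :
    raise j r m (fun y => c * f y) = fun y => c * raise j r m f y := by
  induction m with
  | zero => rfl
  | succ m ih =>
    rw [raise_succ, raise_succ, ih, Eplus_const_mul (hf.raise j r m)]
    funext y
    ring

theorem lower_const_mul (hf : IsSmooth f) (c : ℂ) (m : ℕ) :
    lower j r m (fun y => c * f y) = fun y => c * lower j r m f y := by
  induction m with
  | zero => rfl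
  | succ m ih =>
    rw [lower_succ, lower_succ, ih, Eminus_const_mul (hf.lower j r m)]
    funext y
    ring

theorem shift_const_mul (hf : IsSmooth f) (c : ℂ) (n : ℤ) :
    shift j r n (fun y => c * f y) = fun y => c * shift j r n f y := by
  rw [shift, shift]
  split_ifs
  · exact raise_const_mul hf c _
  · exact lower_const_mul hf c _

theorem lieDeriv_expW_raise (hf : IsSmooth f) (hW : lieDeriv expW j f = fun _ => 0) (m : ℕ) :
    lieDeriv expW j (raise j r m f) = fun y => 2 * Complex.I * m * raise j r m f y := by
  induction m with
  | zero => simpa [raise] using hW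
  | succ m ih =>
    funext y
    have hs := hf.raise j r m
    rw [raise_succ, isOneParam_expW.lieDeriv_const_mul _ (hs.Eplus j), lieDeriv_expW_Eplus hs, ih,
      Eplus_const_mul hs]
    push_cast
    ring

theorem lieDeriv_expW_lower (hf : IsSmooth f) (hW : lieDeriv expW j f = fun _ => 0) (m : ℕ) :
    lieDeriv expW j (lower j r m f) = fun y => -(2 * Complex.I * m) * lower j r m f y := by
  induction m with
  | zero => simpa [lower] using hW
  | succ m ih =>
    funext y
    have hs := hf.lower j r m
    rw [lower_succ, isOneParam_expW.lieDeriv_const_mul _ (hs.Eminus j), lieDeriv_expW_Eminus hs, ih,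
      Eminus_const_mul hs]
    push_cast
    ring

theorem shift_natCast (j : Fin d) (r : ℂ) (m : ℕ) (f : Y Γ → ℂ) :
    shift j r (m : ℤ) f = raise j r m f := by
  simp [shift]

theorem shift_neg_natCast (j : Fin d) (r : ℂ) (m : ℕ) (f : Y Γ → ℂ) :
    shift j r (-(m : ℤ)) f = lower j r m f := by
  rcases Nat.eq_zero_or_pos m with rfl | hm
  · rfl
  · rw [shift, if_neg (by omega)]
    simp

theorem lieDeriv_expW_shift (hf : IsSmooth f) (hW : lieDeriv expW j f = fun _ => 0) (n : ℤ) :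
    lieDeriv expW j (shift j r n f) = fun y => 2 * Complex.I * n * shift j r n f y := by
  obtain ⟨m, rfl | rfl⟩ := Int.eq_nat_or_neg n
  · rw [shift_natCast, lieDeriv_expW_raise hf hW]
    simp
  · rw [shift_neg_natCast, lieDeriv_expW_lower hf hW]
    simp

/-- The ladder relations above weight `0`: by `[E⁺, E⁻] = -4 i W`, the eigenvalue of `E⁻ E⁺` on the
vector of weight `m` is determined by the one on the previous vector. -/
theorem Eminus_Eplus_raise (hf : IsSmooth f) (hW : lieDeriv expW j f = fun _ => 0)
    (hE : ∀ y, Eminus j (Eplus j f) y = -(1 + 4 * r ^ 2) * f y)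
    (hr : ∀ m : ℕ, 2 * Complex.I * r + 1 + 2 * m ≠ 0) (m : ℕ) :
    (∀ y, Eminus j (Eplus j (raise j r m f)) y = (2 * Complex.I * r + 1 + 2 * m) *
      (2 * Complex.I * r - 1 - 2 * m) * raise j r m f y) ∧
    (∀ y, Eminus j (raise j r (m + 1) f) y = (2 * Complex.I * r - 1 - 2 * m) * raise j r m f y) := by
  have hstep : ∀ m : ℕ, (∀ y, Eminus j (Eplus j (raise j r m f)) y =
      (2 * Complex.I * r + 1 + 2 * m) * (2 * Complex.I * r - 1 - 2 * m) * raise j r m f y) →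
      ∀ y, Eminus j (raise j r (m + 1) f) y =
        (2 * Complex.I * r - 1 - 2 * m) * raise j r m f y := by
    intro m h y
    rw [raise_succ, Eminus_const_mul ((hf.raise j r m).Eplus j)]
    simp only [h]
    rw [mul_assoc (2 * Complex.I * r + 1 + 2 * (m : ℂ)), inv_mul_cancel_left₀ (hr m)]
  suffices h : ∀ m : ℕ, ∀ y, Eminus j (Eplus j (raise j r m f)) y =
      (2 * Complex.I * r + 1 + 2 * m) * (2 * Complex.I * r - 1 - 2 * m) * raise j r m f y from
    ⟨h m, hstep m (h m)⟩
  intro m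
  induction m with
  | zero =>
    intro y
    rw [raise, hE]
    push_cast
    linear_combination (-4 * r ^ 2 * f y) * Complex.I_sq
  | succ m ih =>
    intro y
    have h1 := congrFun (raise_succ j r m f) y
    rw [Eminus_Eplus (hf.raise j r (m + 1)), lieDeriv_expW_raise hf hW, funext (hstep m ih),
      Eplus_const_mul (hf.raise j r m)]
    have h2 : Eplus j (raise j r m f) y =
        (2 * Complex.I * r + 1 + 2 * m) * raise j r (m + 1) f y := by
      rw [h1, mul_inv_cancel_left₀ (hr m)]
    simp only [h2]
    push_cast
    linear_combination (8 * (m + 1) * raise j r (m + 1) f y) * Complex.I_sq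

/-- The ladder relation below weight `0`, by the same induction on the weight. -/
theorem Eplus_Eminus_lower (hf : IsSmooth f) (hW : lieDeriv expW j f = fun _ => 0)
    (hE : ∀ y, Eminus j (Eplus j f) y = -(1 + 4 * r ^ 2) * f y)
    (hr : ∀ m : ℕ, 2 * Complex.I * r + 1 + 2 * m ≠ 0) (m : ℕ) :
    ∀ y, Eplus j (lower j r (m + 1) f) y = (2 * Complex.I * r - 1 - 2 * m) * lower j r m f y := by
  have hstep : ∀ m : ℕ, (∀ y, Eplus j (Eminus j (lower j r m f)) y =
      (2 * Complex.I * r + 1 + 2 * m) * (2 * Complex.I * r - 1 - 2 * m) * lower j r m f y) →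
      ∀ y, Eplus j (lower j r (m + 1) f) y =
        (2 * Complex.I * r - 1 - 2 * m) * lower j r m f y := by
    intro m h y
    rw [lower_succ, Eplus_const_mul ((hf.lower j r m).Eminus j)]
    simp only [h]
    rw [mul_assoc (2 * Complex.I * r + 1 + 2 * (m : ℂ)), inv_mul_cancel_left₀ (hr m)]
  refine hstep m ?_
  induction m with
  | zero =>
    intro y
    have h1 := Eminus_Eplus hf j y
    rw [hE, hW] at h1
    rw [lower]
    push_cast
    linear_combination -h1 - (4 * r ^ 2 * f y) * Complex.I_sq
  | succ m ih =>
    intro y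
    have h1 := congrFun (lower_succ j r m f) y
    have h3 := Eminus_Eplus (hf.lower j r (m + 1)) j y
    rw [lieDeriv_expW_lower hf hW, funext (hstep m ih), Eminus_const_mul (hf.lower j r m)] at h3
    have h2 : Eminus j (lower j r m f) y =
        (2 * Complex.I * r + 1 + 2 * m) * lower j r (m + 1) f y := by
      rw [h1, mul_inv_cancel_left₀ (hr m)]
    simp only [h2] at h3
    push_cast at h3 ⊢
    linear_combination -h3 + (8 * (m + 1) * lower j r (m + 1) f y) * Complex.I_sq

theorem Eplus_shift (hf : IsSmooth f) (hW : lieDeriv expW j f = fun _ => 0)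
    (hE : ∀ y, Eminus j (Eplus j f) y = -(1 + 4 * r ^ 2) * f y)
    (hr : ∀ m : ℕ, 2 * Complex.I * r + 1 + 2 * m ≠ 0) (n : ℤ) :
    Eplus j (shift j r n f) =
      fun y => (2 * Complex.I * r + 1 + 2 * n) * shift j r (n + 1) f y := by
  funext y
  obtain ⟨m, rfl⟩ | ⟨m, rfl⟩ : (∃ m : ℕ, n = m) ∨ ∃ m : ℕ, n = -((m + 1 : ℕ) : ℤ) := by
    rcases n with m | m
    · exact .inl ⟨m, rfl⟩
    · exact .inr ⟨m, rfl⟩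
  · have h : ((m : ℤ) + 1) = ((m + 1 : ℕ) : ℤ) := by push_cast; ring
    rw [h, shift_natCast, shift_natCast, raise_succ]
    push_cast
    rw [mul_inv_cancel_left₀ (hr m)]
  · have h : -((m + 1 : ℕ) : ℤ) + 1 = -(m : ℤ) := by push_cast; ring
    rw [h, shift_neg_natCast, shift_neg_natCast, Eplus_Eminus_lower hf hW hE hr]
    push_cast
    ring

theorem Eminus_shift (hf : IsSmooth f) (hW : lieDeriv expW j f = fun _ => 0)
    (hE : ∀ y, Eminus j (Eplus j f) y = -(1 + 4 * r ^ 2) * f y)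
    (hr : ∀ m : ℕ, 2 * Complex.I * r + 1 + 2 * m ≠ 0) (n : ℤ) :
    Eminus j (shift j r n f) =
      fun y => (2 * Complex.I * r + 1 - 2 * n) * shift j r (n - 1) f y := by
  funext y
  obtain ⟨m, rfl⟩ | ⟨m, rfl⟩ : (∃ m : ℕ, n = -(m : ℤ)) ∨ ∃ m : ℕ, n = ((m + 1 : ℕ) : ℤ) := by
    rcases Int.le_total n 0 with h | h
    · exact .inl ⟨n.natAbs, by omega⟩
    · rcases h.eq_or_lt with h | h
      · exact .inl ⟨0, by simp [← h]⟩
      · exact .inr ⟨n.natAbs - 1, by omega⟩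
  · have h : -(m : ℤ) - 1 = -((m + 1 : ℕ) : ℤ) := by push_cast; ring
    rw [h, shift_neg_natCast, shift_neg_natCast, lower_succ]
    push_cast
    rw [mul_neg, sub_neg_eq_add, mul_inv_cancel_left₀ (hr m)]
  · have h : ((m + 1 : ℕ) : ℤ) - 1 = (m : ℤ) := by push_cast; ring
    rw [h, shift_natCast, shift_natCast, (Eminus_Eplus_raise hf hW hE hr m).2]
    push_cast
    ring

/-! ### The functions `φ_n` -/

/-- Apply the shifts by `n` in the factors listed in `l`. -/
def shifts (r : Fin d → ℂ) (n : Fin d → ℤ) (l : List (Fin d)) (f : Y Γ → ℂ) : Y Γ → ℂ :=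
  l.foldl (fun f j => shift j (r j) (n j) f) f

variable {ρ : Fin d → ℂ} {n : Fin d → ℤ} {l : List (Fin d)}

theorem IsSmooth.shifts (hf : IsSmooth f) (ρ : Fin d → ℂ) (n : Fin d → ℤ) (l : List (Fin d)) :
    IsSmooth (shifts ρ n l f) := by
  induction l generalizing f with
  | nil => exact hf
  | cons i l ih => exact ih (hf.shift i (ρ i) (n i))

theorem lieComb_shifts_of_notMem (hf : IsSmooth f) (hj : j ∉ l) (a b c : ℂ) :
    lieComb a b c j (shifts ρ n l f) = shifts ρ n l (lieComb a b c j f) := by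
  induction l generalizing f with
  | nil => rfl
  | cons i l ih =>
    rw [List.mem_cons, not_or] at hj
    have h := ih (hf.shift i (ρ i) (n i)) hj.2
    rw [lieComb_shift_of_ne hf hj.1] at h
    exact h

theorem shifts_const_mul (hf : IsSmooth f) (c : ℂ) :
    shifts ρ n l (fun y => c * f y) = fun y => c * shifts ρ n l f y := by
  induction l generalizing f with
  | nil => rfl
  | cons i l ih =>
    have h := ih (hf.shift i (ρ i) (n i))
    rw [← shift_const_mul hf] at h
    exact h

theorem shifts_congr {n' : Fin d → ℤ} (h : ∀ i ∈ l, n i = n' i) :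
    shifts ρ n l f = shifts ρ n' l f := by
  induction l generalizing f with
  | nil => rfl
  | cons i l ih =>
    change shifts ρ n l (shift i _ (n i) f) = shifts ρ n' l (shift i _ (n' i) f)
    rw [h i (by simp), ih fun k hk => h k (by simp [hk])]

variable {μ : Measure (G d)} (φ : LaplaceEigenfunction Γ μ)

namespace LaplaceEigenfunction

theorem isSmooth_fn (n : Fin d → ℤ) : IsSmooth (φ.fn n) :=
  φ.isSmooth_base.shifts φ.r n (List.finRange d)

theorem fn_zero : φ.fn 0 = φ.base := by
  change shifts φ.r 0 (List.finRange d) φ.base = φ.base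
  induction List.finRange d with
  | nil => rfl
  | cons i l ih => exact ih

/-- Isolate the shift in the `j`-th factor: the function `ψ` it is applied to is, with respect to
this factor, a vector of weight zero with the same eigenvalue as `φ_0`. -/
theorem exists_fn_eq (j : Fin d) (n : Fin d → ℤ) : ∃ (l : List (Fin d)) (ψ : Y Γ → ℂ), j ∉ l ∧
    IsSmooth ψ ∧ lieDeriv expW j ψ = (fun _ => 0) ∧
    (∀ y, Eminus j (Eplus j ψ) y = -(1 + 4 * φ.r j ^ 2) * ψ y) ∧
    ∀ m : ℤ, φ.fn (Function.update n j m) = shifts φ.r n l (shift j (φ.r j) m ψ) := by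
  obtain ⟨l₁, l₂, hl⟩ := List.append_of_mem (List.mem_finRange j)
  have hnd := List.nodup_finRange d
  rw [hl, List.nodup_append, List.nodup_cons] at hnd
  have h1 : j ∉ l₁ := fun h => hnd.2.2 j h j (by simp) rfl
  have h2 : j ∉ l₂ := hnd.2.1.1
  have hs := φ.isSmooth_base
  refine ⟨l₂, shifts φ.r n l₁ φ.base, h2, hs.shifts _ _ _, ?_, fun y => ?_, fun m => ?_⟩
  · rw [lieDeriv_expW_eq_lieComb, lieComb_shifts_of_notMem hs h1, ← lieDeriv_expW_eq_lieComb,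
      show lieDeriv expW j φ.base = fun y => 0 * φ.base y from
        funext fun y => by rw [φ.lieDeriv_expW_base, zero_mul], shifts_const_mul hs]
    simp
  · have hE : Eminus j (Eplus j φ.base) = fun y => -(1 + 4 * φ.r j ^ 2) * φ.base y :=
      funext (φ.Eminus_Eplus_base j)
    rw [Eplus_eq_lieComb, Eminus_eq_lieComb, lieComb_shifts_of_notMem hs h1,
      lieComb_shifts_of_notMem (hs.lieComb _ _ _ j) h1, ← Eplus_eq_lieComb, ← Eminus_eq_lieComb,
      hE, shifts_const_mul hs]
  · change shifts φ.r _ (List.finRange d) φ.base = _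
    rw [hl, shifts, List.foldl_append, List.foldl_cons]
    change shifts φ.r _ l₂ (shift j _ _ (shifts φ.r _ l₁ φ.base)) = _
    rw [Function.update_self,
      shifts_congr (n := Function.update n j m) (n' := n) (l := l₁) fun i hi =>
        Function.update_of_ne (ne_of_mem_of_not_mem hi h1) _ _,
      shifts_congr (n := Function.update n j m) (n' := n) (l := l₂) fun i hi =>
        Function.update_of_ne (ne_of_mem_of_not_mem hi h2) _ _]

/-- `φ_n` has weight `n_j` under `K_j`. -/
theorem lieDeriv_expW_fn (n : Fin d → ℤ) (j : Fin d) :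
    lieDeriv expW j (φ.fn n) = fun y => 2 * Complex.I * n j * φ.fn n y := by
  obtain ⟨l, ψ, hj, hψ, hW, -, hfn⟩ := φ.exists_fn_eq j n
  have h := hfn (n j)
  rw [Function.update_eq_self] at h
  rw [h, lieDeriv_expW_eq_lieComb, lieComb_shifts_of_notMem (hψ.shift _ _ _) hj,
    ← lieDeriv_expW_eq_lieComb, lieDeriv_expW_shift hψ hW, shifts_const_mul (hψ.shift _ _ _)]

variable {φ}

/-- The denominators of the ladder relations have odd real part when `r` is real. -/
theorem int_denominator_ne_zero {r : ℂ} (hr : r.im = 0) (n : ℤ) :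
    2 * Complex.I * r + 1 + 2 * n ≠ 0 := by
  intro h
  have h1 : (1 : ℝ) + 2 * n = 0 := by simpa [hr] using congrArg Complex.re h
  have h2 : 1 + 2 * n = 0 := by exact_mod_cast h1
  omega

theorem nat_denominator_ne_zero {r : ℂ} (hr : r.im = 0) (m : ℕ) :
    2 * Complex.I * r + 1 + 2 * m ≠ 0 := by
  exact_mod_cast int_denominator_ne_zero hr m

theorem Eplus_fn (hr : (φ.r j).im = 0) (n : Fin d → ℤ) :
    Eplus j (φ.fn n) = fun y =>
      (2 * Complex.I * φ.r j + 1 + 2 * n j) * φ.fn (Function.update n j (n j + 1)) y := by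
  obtain ⟨l, ψ, hj, hψ, hW, hE, hfn⟩ := φ.exists_fn_eq j n
  have h := hfn (n j)
  rw [Function.update_eq_self] at h
  rw [h, hfn (n j + 1), Eplus_eq_lieComb, lieComb_shifts_of_notMem (hψ.shift _ _ _) hj,
    ← Eplus_eq_lieComb, Eplus_shift hψ hW hE (nat_denominator_ne_zero hr),
    shifts_const_mul (hψ.shift _ _ _)]

theorem Eminus_fn (hr : (φ.r j).im = 0) (n : Fin d → ℤ) :
    Eminus j (φ.fn n) = fun y =>
      (2 * Complex.I * φ.r j + 1 - 2 * n j) * φ.fn (Function.update n j (n j - 1)) y := by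
  obtain ⟨l, ψ, hj, hψ, hW, hE, hfn⟩ := φ.exists_fn_eq j n
  have h := hfn (n j)
  rw [Function.update_eq_self] at h
  rw [h, hfn (n j - 1), Eminus_eq_lieComb, lieComb_shifts_of_notMem (hψ.shift _ _ _) hj,
    ← Eminus_eq_lieComb, Eminus_shift hψ hW hE (nat_denominator_ne_zero hr),
    shifts_const_mul (hψ.shift _ _ _)]

end LaplaceEigenfunction

end MicrolocalLift

end

noncomputable section

namespace MicrolocalLift

variable {d : ℕ} {Γ : Subgroup (G d)} {j : Fin d} {μ : Measure (G d)}

/-! ### Matrix coefficients `⟨a φ_n, φ_m⟩` -/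

theorem conj_two : conj (2 : ℂ) = 2 := map_ofNat _ 2

theorem Eplus_conj {f : Y Γ → ℂ} (hf : IsSmooth f) (j : Fin d) (y : Y Γ) :
    Eplus j (fun y => conj (f y)) y = conj (Eminus j f y) := by
  simp only [Eplus, Eminus, isOneParam_expH.lieDeriv_conj hf, isOneParam_expX.lieDeriv_conj hf,
    isOneParam_expW.lieDeriv_conj hf]
  simp [conj_two]

theorem Eplus_mul {f g : Y Γ → ℂ} (hf : IsSmooth f) (hg : IsSmooth g) (j : Fin d) (y : Y Γ) :
    Eplus j (fun y => f y * g y) y = Eplus j f y * g y + f y * Eplus j g y := by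
  simp only [Eplus_eq_lieComb]
  exact lieComb_mul hf hg _ _ _ j y

theorem integral_Eplus [DiscreteTopology Γ] [CompactSpace (Y Γ)] [μ.IsHaarMeasure]
    {f : Y Γ → ℂ} (hf : IsSmooth f) (j : Fin d) :
    ∫ y, Eplus j f y ∂(quotientMeasure Γ μ) = 0 := by
  have hH := (isOneParam_expH.lieDeriv_isSmooth hf j).integrable (μ := μ)
  have hX := (isOneParam_expX.lieDeriv_isSmooth hf j).integrable (μ := μ)
  have hW := (isOneParam_expW.lieDeriv_isSmooth hf j).integrable (μ := μ)
  unfold Eplus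
  rw [integral_add hH (by exact ((hX.const_mul 2).sub hW).const_mul _), integral_const_mul,
    integral_sub (hX.const_mul 2) hW, integral_const_mul, isOneParam_expH.integral_lieDeriv hf,
    isOneParam_expX.integral_lieDeriv hf, isOneParam_expW.integral_lieDeriv hf]
  simp

namespace LaplaceEigenfunction

/-- The matrix coefficient `⟨a φ_n, φ_m⟩_Y`. -/
def matCoeff (φ : LaplaceEigenfunction Γ μ) (a : Y Γ → ℂ) (n m : Fin d → ℤ) : ℂ :=
  ∫ y, a y * φ.fn n y * conj (φ.fn m y) ∂(quotientMeasure Γ μ)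

theorem matCoeff_one_self (φ : LaplaceEigenfunction Γ μ) (n : Fin d → ℤ) :
    φ.matCoeff (fun _ => 1) n n = ((∫ y, ‖φ.fn n y‖ ^ 2 ∂(quotientMeasure Γ μ) : ℝ) : ℂ) := by
  rw [matCoeff, ← integral_complex_ofReal]
  congr 1
  funext y
  rw [one_mul, Complex.mul_conj, Complex.normSq_eq_norm_sq]

variable [DiscreteTopology Γ] [CompactSpace (Y Γ)] [μ.IsHaarMeasure]
  {φ : LaplaceEigenfunction Γ μ} {a b : Y Γ → ℂ}

theorem integrable_matCoeff (φ : LaplaceEigenfunction Γ μ) (ha : IsSmooth a) (n m : Fin d → ℤ) :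
    Integrable (fun y => a y * φ.fn n y * conj (φ.fn m y)) (quotientMeasure Γ μ) :=
  ((ha.mul (φ.isSmooth_fn n)).mul (φ.isSmooth_fn m).conj).integrable

/-- Integration by parts for `E_j⁺`: shifting both indices multiplies a matrix coefficient by a ratio
close to one, up to a term of relative size `1 / r_j`. -/
theorem matCoeff_shift (hr : (φ.r j).im = 0) (ha : IsSmooth a) (n m : Fin d → ℤ) :
    (2 * Complex.I * φ.r j + 1 + 2 * n j) *
        φ.matCoeff a (Function.update n j (n j + 1)) (Function.update m j (m j + 1)) =
      (2 * Complex.I * φ.r j + 1 + 2 * m j) * φ.matCoeff a n m -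
        φ.matCoeff (Eplus j a) n (Function.update m j (m j + 1)) := by
  set m' := Function.update m j (m j + 1) with hm'
  set n' := Function.update n j (n j + 1) with hn'
  have hs1 := ha.mul (φ.isSmooth_fn n)
  have hs2 := (φ.isSmooth_fn m').conj
  have hconj : conj (φ.r j) = φ.r j := Complex.conj_eq_iff_im.mpr hr
  have hpt : ∀ y, Eplus j (fun y => a y * φ.fn n y * conj (φ.fn m' y)) y =
      Eplus j a y * φ.fn n y * conj (φ.fn m' y) +
      (2 * Complex.I * φ.r j + 1 + 2 * n j) * (a y * φ.fn n' y * conj (φ.fn m' y)) -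
      (2 * Complex.I * φ.r j + 1 + 2 * m j) * (a y * φ.fn n y * conj (φ.fn m y)) := by
    intro y
    rw [Eplus_mul hs1 hs2, Eplus_mul ha (φ.isSmooth_fn n), Eplus_conj (φ.isSmooth_fn m'),
      Eplus_fn hr, Eminus_fn hr, ← hn']
    have h1 : Function.update m' j (m' j - 1) = m := by
      simp [hm']
    have h2 : m' j = m j + 1 := by simp [hm']
    rw [h1, h2]
    simp [hconj, conj_two]
    ring
  have h := integral_Eplus (μ := μ) (hs1.mul hs2) j
  simp only [hpt] at h
  have i1 := φ.integrable_matCoeff (ha.Eplus j) n m'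
  have i2 := (φ.integrable_matCoeff ha n' m').const_mul (2 * Complex.I * φ.r j + 1 + 2 * n j)
  have i3 := (φ.integrable_matCoeff ha n m).const_mul (2 * Complex.I * φ.r j + 1 + 2 * m j)
  rw [integral_sub (by exact i1.add i2) i3, integral_add i1 i2, integral_const_mul, integral_const_mul] at h
  simp only [matCoeff]
  linear_combination h

/-- Integration by parts for `W_j`. -/
theorem matCoeff_lieDeriv_expW (ha : IsSmooth a) (j : Fin d) (n m : Fin d → ℤ) :
    φ.matCoeff (lieDeriv expW j a) n m =
      -(2 * Complex.I * (n j - m j)) * φ.matCoeff a n m := by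
  have hs1 := ha.mul (φ.isSmooth_fn n)
  have hs2 := (φ.isSmooth_fn m).conj
  have hpt : ∀ y, lieDeriv expW j (fun y => a y * φ.fn n y * conj (φ.fn m y)) y =
      lieDeriv expW j a y * φ.fn n y * conj (φ.fn m y) +
      (2 * Complex.I * (n j - m j)) * (a y * φ.fn n y * conj (φ.fn m y)) := by
    intro y
    rw [isOneParam_expW.lieDeriv_mul hs1 hs2, isOneParam_expW.lieDeriv_mul ha (φ.isSmooth_fn n),
      isOneParam_expW.lieDeriv_conj (φ.isSmooth_fn m), lieDeriv_expW_fn, lieDeriv_expW_fn]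
    simp [conj_two]
    ring
  have h := isOneParam_expW.integral_lieDeriv (μ := μ) (hs1.mul hs2) j
  simp only [hpt] at h
  have i1 := φ.integrable_matCoeff (ha.lieDeriv_expW j) n m
  have i2 := (φ.integrable_matCoeff ha n m).const_mul (2 * Complex.I * (n j - m j))
  rw [integral_add i1 i2, integral_const_mul] at h
  simp only [matCoeff]
  linear_combination h

/-- A `K_j`-invariant function does not couple different `K_j`-weights. -/
theorem matCoeff_eq_zero (ha : IsSmooth a) (hinv : IsInvariantUnderK j a) {n m : Fin d → ℤ}
    (h : n j ≠ m j) : φ.matCoeff a n m = 0 := by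
  have h1 := matCoeff_lieDeriv_expW (φ := φ) ha j n m
  have h2 : lieDeriv expW j a = fun _ => 0 := funext fun y => by
    simp only [lieDeriv, hinv _ y, deriv_const]
  have h3 : φ.matCoeff (fun _ => 0) n m = 0 := by simp [matCoeff]
  have h4 : (n j - m j : ℂ) ≠ 0 := sub_ne_zero.mpr (by exact_mod_cast h)
  rw [h2, h3, eq_comm, neg_mul, neg_eq_zero] at h1
  simpa [h4] using h1

theorem matCoeff_sub (ha : IsSmooth a) (hb : IsSmooth b) (n m : Fin d → ℤ) :
    φ.matCoeff (fun y => a y - b y) n m = φ.matCoeff a n m - φ.matCoeff b n m := by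
  simp only [matCoeff]
  rw [← integral_sub (φ.integrable_matCoeff ha n m) (φ.integrable_matCoeff hb n m)]
  congr 1
  funext y
  ring

/-- Applying `1 - W_j²` twice in every factor multiplies all matrix coefficients by the square of
`∏_j (1 + 4 (n_j - m_j)²)`. -/
theorem exists_matCoeff_eq (ha : IsSmooth a) (s : Finset (Fin d)) : ∃ b : Y Γ → ℂ, IsSmooth b ∧
    ∀ (φ : LaplaceEigenfunction Γ μ) (n m : Fin d → ℤ), φ.matCoeff b n m =
      ((∏ j ∈ s, (1 + 4 * ((n j - m j : ℤ) : ℝ) ^ 2) ^ 2 : ℝ) : ℂ) * φ.matCoeff a n m := by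
  have hstep : ∀ {b : Y Γ → ℂ}, IsSmooth b → ∀ j : Fin d, ∃ c : Y Γ → ℂ, IsSmooth c ∧
      ∀ (φ : LaplaceEigenfunction Γ μ) (n m : Fin d → ℤ), φ.matCoeff c n m =
        (1 + 4 * (n j - m j) ^ 2) * φ.matCoeff b n m := by
    intro b hb j
    have h1 := hb.lieDeriv_expW j
    refine ⟨_, hb.sub (h1.lieDeriv_expW j), fun φ n m => ?_⟩
    rw [matCoeff_sub hb (h1.lieDeriv_expW j), matCoeff_lieDeriv_expW h1, matCoeff_lieDeriv_expW hb]
    linear_combination (-4 * (n j - m j) ^ 2 * φ.matCoeff b n m) * Complex.I_sq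
  induction s using Finset.induction_on with
  | empty => exact ⟨a, ha, fun φ n m => by simp⟩
  | insert j s hj ih =>
    obtain ⟨b, hb, hb'⟩ := ih
    obtain ⟨c, hc, hc'⟩ := hstep hb j
    obtain ⟨e, he, he'⟩ := hstep hc j
    refine ⟨e, he, fun φ n m => ?_⟩
    rw [he', hc', hb', Finset.prod_insert hj]
    push_cast
    ring

end LaplaceEigenfunction

/-- If a function on `ℤ^d` changes by at most `ε_j` when the `j`-th coordinate moves by one, `j ∈ J`,
then at a point `m` supported on `J` it differs from its value at the origin by at most
`∑ |m_j| ε_j`. -/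
theorem norm_sub_zero_le_of_step {E : Type*} [NormedAddCommGroup E] {F : (Fin d → ℤ) → E}
    {J : Finset (Fin d)} {ε : Fin d → ℝ}
    (h : ∀ j ∈ J, ∀ m : Fin d → ℤ, (∀ i ∉ J, m i = 0) →
      ‖F (Function.update m j (m j + 1)) - F m‖ ≤ ε j)
    {m : Fin d → ℤ} (hm : ∀ i ∉ J, m i = 0) : ‖F m - F 0‖ ≤ ∑ j ∈ J, |(m j : ℝ)| * ε j := by
  have hline : ∀ j ∈ J, ∀ m : Fin d → ℤ, (∀ i ∉ J, m i = 0) → ∀ t : ℤ,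
      ‖F (Function.update m j t) - F (Function.update m j 0)‖ ≤ |(t : ℝ)| * ε j := by
    intro j hj m hm t
    have hst : ∀ t : ℤ, ‖F (Function.update m j (t + 1)) - F (Function.update m j t)‖ ≤ ε j := by
      intro t
      have := h j hj (Function.update m j t) fun i hi => by
        rw [Function.update_of_ne (ne_of_mem_of_not_mem hj hi).symm, hm i hi]
      simpa using this
    have hnat : ∀ t : ℕ, ‖F (Function.update m j t) - F (Function.update m j 0)‖ ≤ t * ε j := by
      intro t
      induction t with
      | zero => simp
      | succ t ih =>
        push_cast
        calc _ ≤ _ := norm_sub_le_norm_sub_add_norm_sub _ (F (Function.update m j (t : ℤ))) _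
          _ ≤ ε j + t * ε j := add_le_add (hst t) ih
          _ = _ := by ring
    have hneg : ∀ t : ℕ,
        ‖F (Function.update m j (-(t : ℤ))) - F (Function.update m j 0)‖ ≤ t * ε j := by
      intro t
      induction t with
      | zero => simp
      | succ t ih =>
        push_cast
        have h1 := hst (-(t : ℤ) - 1)
        rw [sub_add_cancel, norm_sub_rev] at h1
        rw [show -((t : ℤ) + 1) = -(t : ℤ) - 1 by ring]
        calc _ ≤ _ := norm_sub_le_norm_sub_add_norm_sub _ (F (Function.update m j (-(t : ℤ)))) _
          _ ≤ ε j + t * ε j := add_le_add h1 ih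
          _ = _ := by ring
    obtain ⟨t, rfl | rfl⟩ := Int.eq_nat_or_neg t
    · simpa using hnat t
    · simpa using hneg t
  suffices hs : ∀ s ⊆ J, ∀ m : Fin d → ℤ, (∀ i ∉ s, m i = 0) →
      ‖F m - F 0‖ ≤ ∑ j ∈ s, |(m j : ℝ)| * ε j from hs J subset_rfl m hm
  intro s
  induction s using Finset.induction_on with
  | empty =>
    intro _ m hm
    have : m = 0 := funext fun i => hm i (by simp)
    simp [this]
  | insert j s hj ih =>
    intro hs m hm
    have hjJ : j ∈ J := hs (Finset.mem_insert_self j s)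
    have hsJ : s ⊆ J := (Finset.subset_insert j s).trans hs
    have h1 := ih hsJ (Function.update m j 0) fun i hi => by
      by_cases hij : i = j
      · subst hij; simp
      · rw [Function.update_of_ne hij]
        exact hm i (by simp [hij, hi])
    have h2 := hline j hjJ m (fun i hi => hm i fun h => hi (hs h)) (m j)
    rw [Function.update_eq_self] at h2
    have h3 : ∑ i ∈ s, |(Function.update m j 0 i : ℝ)| * ε i = ∑ i ∈ s, |(m i : ℝ)| * ε i :=
      Finset.sum_congr rfl fun i hi => by
        rw [Function.update_of_ne (ne_of_mem_of_not_mem hi hj)]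
    rw [Finset.sum_insert hj, ← h3]
    exact (norm_sub_le_norm_sub_add_norm_sub _ _ _).trans (add_le_add h2 h1)

/-- The summable weight `∏_j (1 + k_j²)⁻¹` on `ℤ^d`. -/
def decayWeight (k : Fin d → ℤ) : ℝ := ∏ j, (1 + (k j : ℝ) ^ 2)⁻¹

theorem decayWeight_pos (k : Fin d → ℤ) : 0 < decayWeight k :=
  Finset.prod_pos fun j _ => by positivity

theorem summable_decayWeight : Summable (decayWeight (d := d)) := by
  have h1 : Summable fun k : ℤ => (1 + (k : ℝ) ^ 2)⁻¹ := by
    refine Summable.of_norm_bounded_eventually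
      ((Real.summable_one_div_int_pow (p := 2)).mpr one_lt_two) ?_
    have h0 : ∀ᶠ k : ℤ in cofinite, k ≠ 0 := (Set.finite_singleton 0).compl_mem_cofinite
    filter_upwards [h0] with k hk
    have hk' : (k : ℝ) ≠ 0 := by exact_mod_cast hk
    have hk2 : 0 < (k : ℝ) ^ 2 := by positivity
    rw [Real.norm_of_nonneg (by positivity), one_div]
    exact inv_anti₀ hk2 (by linarith)
  refine summable_of_sum_le (c := ∏ _j : Fin d, ∑' k : ℤ, (1 + (k : ℝ) ^ 2)⁻¹)
    (fun k => (decayWeight_pos k).le) fun u => ?_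
  have hsub : u ⊆ Fintype.piFinset fun j => u.image fun k : Fin d → ℤ => k j := by
    intro k hk
    exact Fintype.mem_piFinset.mpr fun j => Finset.mem_image_of_mem (fun k : Fin d → ℤ => k j) hk
  calc ∑ k ∈ u, decayWeight k
      ≤ ∑ k ∈ Fintype.piFinset fun j => u.image fun k : Fin d → ℤ => k j, decayWeight k :=
        Finset.sum_le_sum_of_subset_of_nonneg hsub fun k _ _ => (decayWeight_pos k).le
    _ = ∏ j, ∑ k ∈ u.image fun k : Fin d → ℤ => k j, (1 + (k : ℝ) ^ 2)⁻¹ :=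
        (Finset.prod_univ_sum _ fun _ (k : ℤ) => (1 + (k : ℝ) ^ 2)⁻¹).symm
    _ ≤ _ := Finset.prod_le_prod (fun j _ => Finset.sum_nonneg fun k _ => by positivity)
        fun j _ => h1.sum_le_tsum _ fun k _ => by positivity

theorem prod_inv_le_decayWeight (k : Fin d → ℤ) :
    (∏ j, (1 + 4 * (k j : ℝ) ^ 2) ^ 2)⁻¹ ≤ decayWeight k := by
  rw [← Finset.prod_inv_distrib]
  refine Finset.prod_le_prod (fun i _ => by positivity) fun i _ => inv_anti₀ (by positivity) ?_
  nlinarith [sq_nonneg (k i : ℝ), sq_nonneg ((k i : ℝ) ^ 2)]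

theorem decayWeight_mul_prod_le (k : Fin d → ℤ) (j : Fin d) :
    (1 + |(k j : ℝ)|) * (∏ j, (1 + 4 * (k j : ℝ) ^ 2) ^ 2)⁻¹ ≤ 2 * decayWeight k := by
  have hb : ∀ t : ℤ, (1 + |(t : ℝ)|) * (1 + 4 * (t : ℝ) ^ 2)⁻¹ ≤ 2 := by
    intro t
    rw [← div_eq_mul_inv, div_le_iff₀ (by positivity), ← sq_abs (t : ℝ)]
    nlinarith [sq_nonneg (|(t : ℝ)| - 1), abs_nonneg (t : ℝ)]
  have hsplit : (∏ j, (1 + 4 * (k j : ℝ) ^ 2) ^ 2)⁻¹ =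
      (∏ j, (1 + 4 * (k j : ℝ) ^ 2)⁻¹) * ∏ j, (1 + 4 * (k j : ℝ) ^ 2)⁻¹ := by
    rw [← Finset.prod_inv_distrib, ← Finset.prod_mul_distrib]
    exact Finset.prod_congr rfl fun i _ => by rw [sq, mul_inv]
  have h1 : ∏ j, (1 + 4 * (k j : ℝ) ^ 2)⁻¹ ≤ (1 + 4 * (k j : ℝ) ^ 2)⁻¹ := by
    rw [← Finset.mul_prod_erase _ _ (Finset.mem_univ j)]
    refine mul_le_of_le_one_right (by positivity)
      (Finset.prod_le_one (fun i _ => by positivity) fun i _ => ?_)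
    exact inv_le_one_of_one_le₀ (by nlinarith [sq_nonneg (k i : ℝ)])
  have h2 : ∏ j, (1 + 4 * (k j : ℝ) ^ 2)⁻¹ ≤ decayWeight k :=
    Finset.prod_le_prod (fun i _ => by positivity) fun i _ =>
      inv_anti₀ (by positivity) (by nlinarith [sq_nonneg (k i : ℝ)])
  have h0 : 0 ≤ ∏ j, (1 + 4 * (k j : ℝ) ^ 2)⁻¹ := Finset.prod_nonneg fun i _ => by positivity
  rw [hsplit, ← mul_assoc]
  refine mul_le_mul ?_ h2 h0 zero_le_two
  exact (mul_le_mul_of_nonneg_left h1 (by positivity)).trans (hb (k j))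

/-- Moving one coordinate of `k` by one changes `decayWeight k` by a bounded factor. -/
theorem decayWeight_update_le (k : Fin d → ℤ) (j : Fin d) :
    decayWeight (Function.update k j (k j - 1)) ≤ 3 * decayWeight k := by
  unfold decayWeight
  rw [← Finset.mul_prod_erase _ _ (Finset.mem_univ j),
    ← Finset.mul_prod_erase (f := fun j => (1 + (k j : ℝ) ^ 2)⁻¹) _ (Finset.mem_univ j),
    ← mul_assoc, Finset.prod_congr (g := fun i => (1 + (k i : ℝ) ^ 2)⁻¹) rfl fun i hi => by
      rw [Function.update_of_ne (Finset.ne_of_mem_erase hi)]]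
  refine mul_le_mul_of_nonneg_right ?_ (Finset.prod_nonneg fun i _ => by positivity)
  rw [Function.update_self, ← div_eq_mul_inv, le_div_iff₀ (by positivity),
    ← div_eq_inv_mul, div_le_iff₀ (by positivity)]
  push_cast
  nlinarith [sq_nonneg ((k j : ℝ) - 2), sq_nonneg ((k j : ℝ) - 1)]

namespace LaplaceEigenfunction

variable [DiscreteTopology Γ] [CompactSpace (Y Γ)] [μ.IsHaarMeasure]
  {φ : LaplaceEigenfunction Γ μ} {a b : Y Γ → ℂ} {J : Finset (Fin d)}

/-- For real `r_j`, `j ∈ J`, the functions `φ_n` with `n` supported on `J` are normalized. -/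
theorem matCoeff_one_eq_one (hJ : ∀ j ∈ J, (φ.r j).im = 0) {n : Fin d → ℤ}
    (hn : ∀ i ∉ J, n i = 0) : φ.matCoeff (fun _ => 1) n n = 1 := by
  have h0 : φ.matCoeff (fun _ => 1) 0 0 = 1 := by
    rw [matCoeff_one_self, fn_zero, φ.normalized, Complex.ofReal_one]
  have h := norm_sub_zero_le_of_step (F := fun n => φ.matCoeff (fun _ => 1) n n) (J := J)
    (ε := 0) (fun j hj m _ => by
      have h1 := matCoeff_shift (hJ j hj) (isSmooth_const 1) m m
      have h2 : Eplus j (fun _ : Y Γ => (1 : ℂ)) = fun _ => 0 := funext fun y => by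
        simp [Eplus, lieDeriv_const]
      have h3 : ∀ n m, φ.matCoeff (fun _ => 0) n m = 0 := fun n m => by simp [matCoeff]
      rw [h2, h3, sub_zero] at h1
      have h4 := mul_left_cancel₀ (int_denominator_ne_zero (hJ j hj) (m j)) h1
      simp [h4]) hn
  simp only [Pi.zero_apply, mul_zero, Finset.sum_const_zero, norm_le_zero_iff, sub_eq_zero] at h
  rw [h, h0]

theorem integral_norm_sq_fn (hJ : ∀ j ∈ J, (φ.r j).im = 0) {n : Fin d → ℤ}
    (hn : ∀ i ∉ J, n i = 0) : ∫ y, ‖φ.fn n y‖ ^ 2 ∂(quotientMeasure Γ μ) = 1 := by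
  have h := matCoeff_one_eq_one hJ hn
  rw [matCoeff_one_self] at h
  exact_mod_cast h

theorem integrable_norm_sq_fn (φ : LaplaceEigenfunction Γ μ) (n : Fin d → ℤ) :
    Integrable (fun y => ‖φ.fn n y‖ ^ 2) (quotientMeasure Γ μ) := by
  have h := ((φ.isSmooth_fn n).mul (φ.isSmooth_fn n)).integrable (μ := μ).norm
  simpa [← sq] using h

theorem norm_matCoeff_le (hJ : ∀ j ∈ J, (φ.r j).im = 0) {C : ℝ} (hC : ∀ y, ‖a y‖ ≤ C)
    {n m : Fin d → ℤ} (hn : ∀ i ∉ J, n i = 0) (hm : ∀ i ∉ J, m i = 0) :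
    ‖φ.matCoeff a n m‖ ≤ C := by
  have hi : Integrable (fun y => C * ((‖φ.fn n y‖ ^ 2 + ‖φ.fn m y‖ ^ 2) / 2))
      (quotientMeasure Γ μ) :=
    (((φ.integrable_norm_sq_fn n).add (φ.integrable_norm_sq_fn m)).div_const 2).const_mul C
  refine (norm_integral_le_of_norm_le hi (Eventually.of_forall fun y => ?_)).trans_eq ?_
  · rw [norm_mul, norm_mul, RCLike.norm_conj, mul_assoc]
    refine mul_le_mul (hC y) ?_ (by positivity) ((norm_nonneg _).trans (hC y))
    nlinarith [sq_nonneg (‖φ.fn n y‖ - ‖φ.fn m y‖)]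
  · rw [integral_const_mul, integral_div,
      integral_add (φ.integrable_norm_sq_fn n) (φ.integrable_norm_sq_fn m),
      integral_norm_sq_fn hJ hn, integral_norm_sq_fn hJ hm]
    norm_num

/-- The matrix coefficients decay away from the diagonal, uniformly in `φ`. -/
theorem exists_decay (ha : IsSmooth a) : ∃ C : ℝ, 0 ≤ C ∧ ∀ (φ : LaplaceEigenfunction Γ μ)
    (J : Finset (Fin d)), (∀ j ∈ J, (φ.r j).im = 0) → ∀ n m : Fin d → ℤ, (∀ i ∉ J, n i = 0) →
    (∀ i ∉ J, m i = 0) → ‖φ.matCoeff a n m‖ ≤ C * decayWeight (n - m) ∧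
    ∀ j, (1 + |((n - m) j : ℝ)|) * ‖φ.matCoeff a n m‖ ≤ C * decayWeight (n - m) := by
  obtain ⟨b, hb, hab⟩ := exists_matCoeff_eq (μ := μ) ha Finset.univ
  obtain ⟨C, hC0, hC⟩ := hb.exists_bound
  refine ⟨2 * C, by positivity, fun φ J hJ n m hn hm => ?_⟩
  have h1 := norm_matCoeff_le hJ hC hn hm
  set P : ℝ := ∏ j, (1 + 4 * ((n j - m j : ℤ) : ℝ) ^ 2) ^ 2 with hP
  have hP0 : 0 < P := Finset.prod_pos fun j _ => by positivity
  rw [hab, norm_mul, Complex.norm_of_nonneg hP0.le, mul_comm, ← le_div_iff₀ hP0,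
    div_eq_mul_inv] at h1
  refine ⟨h1.trans ?_, fun j => ?_⟩
  · have h2 := mul_le_mul_of_nonneg_left (prod_inv_le_decayWeight (n - m)) hC0
    exact h2.trans (by nlinarith [decayWeight_pos (n - m)])
  calc (1 + |((n - m) j : ℝ)|) * ‖φ.matCoeff a n m‖
      ≤ (1 + |((n - m) j : ℝ)|) * (C * P⁻¹) := mul_le_mul_of_nonneg_left h1 (by positivity)
    _ = C * ((1 + |((n - m) j : ℝ)|) * P⁻¹) := by ring
    _ ≤ C * (2 * decayWeight (n - m)) :=
        mul_le_mul_of_nonneg_left (decayWeight_mul_prod_le (n - m) j) hC0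
    _ = 2 * C * decayWeight (n - m) := by ring

/-- Shifting both indices of a matrix coefficient by one changes it by `O(1 / r_j)`. -/
theorem exists_shift_bound (ha : IsSmooth a) : ∃ C : ℝ, 0 ≤ C ∧
    ∀ (φ : LaplaceEigenfunction Γ μ) (J : Finset (Fin d)),
    (∀ j ∈ J, (φ.r j).im = 0 ∧ 0 < (φ.r j).re) → ∀ j ∈ J, ∀ n m : Fin d → ℤ,
    (∀ i ∉ J, n i = 0) → (∀ i ∉ J, m i = 0) →
    ‖φ.matCoeff a (Function.update n j (n j + 1)) (Function.update m j (m j + 1)) -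
      φ.matCoeff a n m‖ ≤ C * ((φ.r j).re)⁻¹ * decayWeight (n - m) := by
  obtain ⟨C₁, hC₁, h₁⟩ := exists_decay (μ := μ) ha
  choose C₂ hC₂ h₂ using fun j => exists_decay (μ := μ) (ha.Eplus j)
  refine ⟨C₁ + ∑ j, 3 * C₂ j, add_nonneg hC₁ (Finset.sum_nonneg fun j _ => by
    have := hC₂ j; positivity), fun φ J hJ j hj n m hn hm => ?_⟩
  obtain ⟨hr, hr0⟩ := hJ j hj
  have hJ' : ∀ j ∈ J, (φ.r j).im = 0 := fun j hj => (hJ j hj).1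
  set m' := Function.update m j (m j + 1) with hm'
  set n' := Function.update n j (n j + 1) with hn'
  set w := decayWeight (n - m) with hw
  have hw0 : 0 < w := decayWeight_pos _
  have hm'J : ∀ i ∉ J, m' i = 0 := fun i hi => by
    rw [hm', Function.update_of_ne (ne_of_mem_of_not_mem hj hi).symm, hm i hi]
  have hid := matCoeff_shift hr ha n m
  rw [← hm', ← hn'] at hid
  set z : ℂ := 2 * Complex.I * φ.r j + 1 + 2 * n j with hz
  -- the imaginary part of `2 i r_j + 1 + 2 n_j` is `2 r_j`, whatever `n_j` is
  have hz2 : 2 * (φ.r j).re ≤ ‖z‖ := by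
    have h := Complex.abs_im_le_norm z
    have him : z.im = 2 * (φ.r j).re := by simp [hz]
    rw [him, abs_of_pos (by positivity)] at h
    exact h
  have hdiff : z * (φ.matCoeff a n' m' - φ.matCoeff a n m) =
      -(2 * (((n - m) j : ℤ) : ℂ)) * φ.matCoeff a n m - φ.matCoeff (Eplus j a) n m' := by
    rw [mul_sub, hid, hz]
    simp
    ring
  have hX : |((n - m) j : ℝ)| * ‖φ.matCoeff a n m‖ ≤ C₁ * w :=
    (mul_le_mul_of_nonneg_right (by linarith) (norm_nonneg _)).trans ((h₁ φ J hJ' n m hn hm).2 j)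
  have hY : ‖φ.matCoeff (Eplus j a) n m'‖ ≤ 3 * C₂ j * w := by
    have h := (h₂ j φ J hJ' n m' hn hm'J).2 j
    have hnm : n - m' = Function.update (n - m) j ((n - m) j - 1) := by
      funext i
      by_cases hij : i = j
      · subst hij; simp [hm']; ring
      · simp [hm', hij]
    have h3 := decayWeight_update_le (n - m) j
    rw [← hnm] at h3
    have h4 : ‖φ.matCoeff (Eplus j a) n m'‖ ≤
        (1 + |((n - m') j : ℝ)|) * ‖φ.matCoeff (Eplus j a) n m'‖ :=
      le_mul_of_one_le_left (norm_nonneg _) (by linarith [abs_nonneg ((n - m') j : ℝ)])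
    nlinarith [mul_le_mul_of_nonneg_left h3 (hC₂ j)]
  have hC₂j : 3 * C₂ j ≤ ∑ j, 3 * C₂ j :=
    Finset.single_le_sum (f := fun j => 3 * C₂ j) (fun i _ => by have := hC₂ i; positivity)
      (Finset.mem_univ j)
  have hnorm : ‖z‖ * ‖φ.matCoeff a n' m' - φ.matCoeff a n m‖ ≤ 2 * (C₁ * w) + 3 * C₂ j * w := by
    rw [← norm_mul, hdiff]
    refine (norm_sub_le _ _).trans (add_le_add ?_ hY)
    rw [norm_mul, norm_neg, norm_mul, Complex.norm_intCast, Complex.norm_ofNat, mul_assoc]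
    exact mul_le_mul_of_nonneg_left hX zero_le_two
  have hfin : 2 * (φ.r j).re * ‖φ.matCoeff a n' m' - φ.matCoeff a n m‖ ≤
      2 * ((C₁ + ∑ j, 3 * C₂ j) * w) := by
    refine (mul_le_mul_of_nonneg_right hz2 (norm_nonneg _)).trans (hnorm.trans ?_)
    have h5 : 0 ≤ C₂ j * w := mul_nonneg (hC₂ j) hw0.le
    nlinarith [mul_le_mul_of_nonneg_right hC₂j hw0.le]
  rw [mul_right_comm, ← div_eq_mul_inv, le_div_iff₀ hr0]
  linarith

end LaplaceEigenfunction

end MicrolocalLift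

end

noncomputable section

namespace MicrolocalLift

variable {d : ℕ} {Γ : Subgroup (G d)} {μ : Measure (G d)}

/-! ### Averaging over a box -/

/-- The box of all `n ∈ ℤ^d` supported on `J` with `‖n‖_∞ ≤ N`. -/
def box (J : Finset (Fin d)) (N : ℕ) : Finset (Fin d → ℤ) :=
  Fintype.piFinset fun j => if j ∈ J then Finset.Icc (-(N : ℤ)) N else {0}

variable {J : Finset (Fin d)} {N : ℕ}

theorem mem_box {m : Fin d → ℤ} :
    m ∈ box J N ↔ (∀ j ∈ J, m j ∈ Finset.Icc (-(N : ℤ)) N) ∧ ∀ j ∉ J, m j = 0 := by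
  rw [box, Fintype.mem_piFinset]
  refine ⟨fun h => ⟨fun j hj => by simpa [hj] using h j, fun j hj => by simpa [hj] using h j⟩,
    fun h j => ?_⟩
  by_cases hj : j ∈ J
  · simpa [hj] using h.1 j hj
  · simpa [hj] using h.2 j hj

theorem card_box_pos (J : Finset (Fin d)) (N : ℕ) : 0 < (box J N).card :=
  Finset.card_pos.mpr ⟨0, mem_box.mpr ⟨fun j _ => by simp, fun j _ => rfl⟩⟩

theorem card_filter_Icc_le (N : ℕ) (k : ℤ) :
    ((Finset.Icc (-(N : ℤ)) N).filter fun t => k + t ∉ Finset.Icc (-(N : ℤ)) N).card ≤ k.natAbs := by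
  rcases le_total 0 k with hk | hk
  · refine (Finset.card_le_card (t := Finset.Ioc (N - k) N) fun t ht => ?_).trans ?_
    · simp only [Finset.mem_filter, Finset.mem_Icc, Finset.mem_Ioc] at ht ⊢
      omega
    · rw [Int.card_Ioc]
      omega
  · refine (Finset.card_le_card (t := Finset.Ico (-(N : ℤ)) (-N - k)) fun t ht => ?_).trans ?_
    · simp only [Finset.mem_filter, Finset.mem_Icc, Finset.mem_Ico] at ht ⊢
      omega
    · rw [Int.card_Ico]
      omega

/-- Translation by `k` moves only a proportion `|k_j| / (2N + 1)` of the box out of the box in the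
`j`-th direction. -/
theorem card_filter_box_le {j : Fin d} (hj : j ∈ J) (N : ℕ) (k : ℤ) :
    (2 * N + 1) * ((box J N).filter fun m => k + m j ∉ Finset.Icc (-(N : ℤ)) N).card ≤
      k.natAbs * (box J N).card := by
  set s : Fin d → Finset ℤ := fun j => if j ∈ J then Finset.Icc (-(N : ℤ)) N else {0} with hs
  have hsj : s j = Finset.Icc (-(N : ℤ)) N := if_pos hj
  set t : Finset ℤ := (Finset.Icc (-(N : ℤ)) N).filter fun t => k + t ∉ Finset.Icc (-(N : ℤ)) N
    with ht
  have hsub : ((box J N).filter fun m => k + m j ∉ Finset.Icc (-(N : ℤ)) N) ⊆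
      Fintype.piFinset (Function.update s j t) := by
    intro m hm
    obtain ⟨hmB, hmj⟩ := Finset.mem_filter.mp hm
    refine Fintype.mem_piFinset.mpr fun i => ?_
    by_cases hi : i = j
    · subst hi
      rw [Function.update_self, ht, Finset.mem_filter]
      exact ⟨(mem_box.mp hmB).1 i hj, hmj⟩
    · rw [Function.update_of_ne hi]
      exact Fintype.mem_piFinset.mp hmB i
  have hcard := Finset.card_le_card hsub
  have hIcc : (s j).card = 2 * N + 1 := by
    rw [hsj, Int.card_Icc]
    omega
  rw [Fintype.card_piFinset, ← Finset.mul_prod_erase _ _ (Finset.mem_univ j),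
    Function.update_self, Finset.prod_congr (g := fun i => (s i).card) rfl fun i hi => by
      rw [Function.update_of_ne (Finset.ne_of_mem_erase hi)]] at hcard
  have hbox : (box J N).card = (2 * N + 1) * ∏ i ∈ Finset.univ.erase j, (s i).card := by
    rw [box, Fintype.card_piFinset, ← Finset.mul_prod_erase _ _ (Finset.mem_univ j), ← hIcc]
  rw [hbox]
  calc _ ≤ (2 * N + 1) * (t.card * ∏ i ∈ Finset.univ.erase j, (s i).card) :=
        Nat.mul_le_mul_left _ hcard
    _ ≤ (2 * N + 1) * (k.natAbs * ∏ i ∈ Finset.univ.erase j, (s i).card) :=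
        Nat.mul_le_mul_left _ (Nat.mul_le_mul_right _ (card_filter_Icc_le N k))
    _ = _ := by ring

/-- If `T (k + m) m` is close to `T k 0` and decays in `k`, then the normalized sum of `T` over the
square of a box is close to `∑ k, T k 0`. -/
theorem norm_tsum_sub_average_le {T : (Fin d → ℤ) → (Fin d → ℤ) → ℂ} {A D : ℝ} (hD : 0 ≤ D)
    (hzero : ∀ k : Fin d → ℤ, (∃ i ∉ J, k i ≠ 0) → T k 0 = 0)
    (hdecay : ∀ k, ‖T k 0‖ ≤ A * decayWeight k)
    (hdecay' : ∀ k j, |(k j : ℝ)| * ‖T k 0‖ ≤ A * decayWeight k)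
    (hshift : ∀ k : Fin d → ℤ, (∀ i ∉ J, k i = 0) → ∀ m ∈ box J N,
      ‖T (k + m) m - T k 0‖ ≤ D * decayWeight k) :
    ‖∑' k, T k 0 - ((box J N).card : ℂ)⁻¹ * ∑ n ∈ box J N, ∑ m ∈ box J N, T n m‖ ≤
      (D + J.card * (A / (2 * N + 1))) * ∑' k : Fin d → ℤ, decayWeight k := by
  classical
  set B := box J N with hB
  have hB0 : (0 : ℝ) < B.card := by exact_mod_cast card_box_pos J N
  have hsum : Summable fun k => T k 0 :=
    .of_norm_bounded (summable_decayWeight.mul_left A) hdecay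
  -- for fixed `m`, sum over the difference `k = n - m`
  have hm : ∀ m ∈ B, HasSum (fun k => T k 0 - if k + m ∈ B then T (k + m) m else 0)
      (∑' k, T k 0 - ∑ n ∈ B, T n m) := by
    intro m _
    have h1 : HasSum (fun n => if n ∈ B then T n m else 0) (∑ n ∈ B, T n m) := by
      rw [← Finset.sum_congr (f := fun n => if n ∈ B then T n m else 0) rfl fun n hn => if_pos hn]
      exact hasSum_sum_of_ne_finset_zero fun n hn => if_neg hn
    have h2 : HasSum (fun k => if k + m ∈ B then T (k + m) m else 0) (∑ n ∈ B, T n m) :=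
      (Equiv.hasSum_iff (f := fun n => if n ∈ B then T n m else 0) (Equiv.addRight m)).mpr h1
    exact hsum.hasSum.sub h2
  have htot := hasSum_sum hm
  have hbound : ∀ k : Fin d → ℤ,
      ‖∑ m ∈ B, (T k 0 - if k + m ∈ B then T (k + m) m else 0)‖ ≤
        B.card * (D + J.card * (A / (2 * N + 1))) * decayWeight k := by
    intro k
    have hw := decayWeight_pos k
    have hAw : 0 ≤ A * decayWeight k := (norm_nonneg _).trans (hdecay k)
    -- unless `k` is supported on `J` all terms vanish; otherwise the terms with `k + m` in the box
    -- are bounded by `hshift`, and the others are few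
    by_cases hk : ∃ i ∉ J, k i ≠ 0
    · obtain ⟨i, hi, hki⟩ := hk
      have hz : ∑ m ∈ B, (T k 0 - if k + m ∈ B then T (k + m) m else 0) = 0 := by
        refine Finset.sum_eq_zero fun m hm => ?_
        rw [hzero k ⟨i, hi, hki⟩, if_neg, sub_zero]
        intro h
        have h1 := (mem_box.mp h).2 i hi
        rw [Pi.add_apply, (mem_box.mp hm).2 i hi, add_zero] at h1
        exact hki h1
      rw [hz, norm_zero, mul_assoc, add_mul, mul_assoc, div_mul_eq_mul_div]
      positivity
    · push Not at hk
      have hterm : ∀ m ∈ B, ‖T k 0 - if k + m ∈ B then T (k + m) m else 0‖ ≤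
          D * decayWeight k +
            ∑ j ∈ J, if k j + m j ∉ Finset.Icc (-(N : ℤ)) N then ‖T k 0‖ else 0 := by
        intro m hm
        have hnn : ∀ j ∈ J, 0 ≤ if k j + m j ∉ Finset.Icc (-(N : ℤ)) N then ‖T k 0‖ else 0 :=
          fun j _ => by split_ifs <;> positivity
        by_cases hkm : k + m ∈ B
        · rw [if_pos hkm, norm_sub_rev]
          exact (hshift k hk m hm).trans (le_add_of_nonneg_right (Finset.sum_nonneg hnn))
        · rw [if_neg hkm, sub_zero]
          obtain ⟨j, hj, hjN⟩ : ∃ j ∈ J, k j + m j ∉ Finset.Icc (-(N : ℤ)) N := by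
            by_contra hcon
            push Not at hcon
            refine hkm (mem_box.mpr ⟨hcon, fun i hi => ?_⟩)
            rw [Pi.add_apply, hk i hi, (mem_box.mp hm).2 i hi, add_zero]
          refine le_add_of_nonneg_of_le (by positivity) ?_
          refine le_trans (le_of_eq ?_) (Finset.single_le_sum hnn hj)
          rw [if_pos hjN]
      have hcount : ∀ j ∈ J,
          ∑ m ∈ B, (if k j + m j ∉ Finset.Icc (-(N : ℤ)) N then ‖T k 0‖ else 0) ≤
            B.card * (A / (2 * N + 1)) * decayWeight k := by
        intro j hj
        rw [← Finset.sum_filter, Finset.sum_const, nsmul_eq_mul]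
        have h1 : ((2 * N + 1 : ℕ) : ℝ) *
            ((B.filter fun m => k j + m j ∉ Finset.Icc (-(N : ℤ)) N).card : ℝ) ≤
              |(k j : ℝ)| * B.card := by
          have h := card_filter_box_le hj N (k j)
          have h' : |(k j : ℝ)| = ((k j).natAbs : ℝ) := by
            rw [Nat.cast_natAbs, Int.cast_abs]
          rw [h']
          exact_mod_cast h
        have h2 := mul_le_mul_of_nonneg_right h1 (norm_nonneg (T k 0))
        have h3 := mul_le_mul_of_nonneg_left (hdecay' k j) hB0.le
        rw [mul_div_assoc', div_mul_eq_mul_div, le_div_iff₀ (by positivity)]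
        push_cast at h2
        linarith
      calc _ ≤ ∑ m ∈ B, ‖T k 0 - if k + m ∈ B then T (k + m) m else 0‖ := norm_sum_le _ _
        _ ≤ ∑ m ∈ B, (D * decayWeight k +
            ∑ j ∈ J, if k j + m j ∉ Finset.Icc (-(N : ℤ)) N then ‖T k 0‖ else 0) :=
          Finset.sum_le_sum hterm
        _ = B.card * (D * decayWeight k) +
            ∑ j ∈ J, ∑ m ∈ B, (if k j + m j ∉ Finset.Icc (-(N : ℤ)) N then ‖T k 0‖ else 0) := by
          rw [Finset.sum_add_distrib, Finset.sum_const, nsmul_eq_mul, Finset.sum_comm]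
        _ ≤ B.card * (D * decayWeight k) +
            ∑ j ∈ J, B.card * (A / (2 * N + 1)) * decayWeight k :=
          add_le_add_right (Finset.sum_le_sum hcount) _
        _ = _ := by
          rw [Finset.sum_const, nsmul_eq_mul]
          ring
  have hnorm := htot.norm_le_of_bounded
    (summable_decayWeight.hasSum.mul_left (B.card * (D + J.card * (A / (2 * N + 1))))) hbound
  have hBc : (B.card : ℂ) ≠ 0 := by exact_mod_cast hB0.ne'
  have heq : ∑' k, T k 0 - (B.card : ℂ)⁻¹ * ∑ n ∈ B, ∑ m ∈ B, T n m =
      (B.card : ℂ)⁻¹ * ∑ m ∈ B, (∑' k, T k 0 - ∑ n ∈ B, T n m) := by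
    rw [Finset.sum_sub_distrib, Finset.sum_const, nsmul_eq_mul, mul_sub, inv_mul_cancel_left₀ hBc,
      Finset.sum_comm]
  rw [heq, norm_mul, norm_inv, Complex.norm_natCast, inv_mul_le_iff₀ hB0]
  linarith

end MicrolocalLift

end

noncomputable section

namespace MicrolocalLift

variable {d : ℕ} {Γ : Subgroup (G d)} {μ : Measure (G d)}

/-! ### The approximating states -/

namespace LaplaceEigenfunction

/-- The normalized sum of the functions `φ_n` over a box. -/
def boxState (φ : LaplaceEigenfunction Γ μ) (J : Finset (Fin d)) (N : ℕ) (y : Y Γ) : ℂ :=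
  ((√((box J N).card : ℝ))⁻¹ : ℝ) * ∑ n ∈ box J N, φ.fn n y

theorem isSmooth_boxState (φ : LaplaceEigenfunction Γ μ) (J : Finset (Fin d)) (N : ℕ) :
    IsSmooth (φ.boxState J N) :=
  (IsSmooth.sum (box J N) φ.isSmooth_fn).const_mul _

/-- The size of the error term, `max_{j ∈ J} r_j^{-1/4}`. -/
def errorTerm (φ : LaplaceEigenfunction Γ μ) (J : Finset (Fin d)) : ℝ :=
  ⨆ j : J, (φ.r j).re ^ (-(1 / 4) : ℝ)

theorem rpow_le_errorTerm {J : Finset (Fin d)} (φ : LaplaceEigenfunction Γ μ) {j : Fin d} (hj : j ∈ J) :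
    (φ.r j).re ^ (-(1 / 4) : ℝ) ≤ φ.errorTerm J :=
  le_ciSup (f := fun j : J => (φ.r j).re ^ (-(1 / 4) : ℝ)) (Set.finite_range _).bddAbove ⟨j, hj⟩

/-- The side length of the box: for `N ≈ min r_j^{1/4}` both the boundary error `1 / N` and the
error `N / r_j` made by shifting indices are at most of size `max r_j^{-1/4}`. -/
def boxSize (φ : LaplaceEigenfunction Γ μ) (J : Finset (Fin d)) : ℕ := ⌊(φ.errorTerm J)⁻¹⌋₊

theorem boxSize_bounds {φ : LaplaceEigenfunction Γ μ} {J : Finset (Fin d)}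
    (hJ : ∀ j ∈ J, (φ.r j).im = 0 ∧ 0 < (φ.r j).re) {j : Fin d} (hj : j ∈ J) :
    1 / (2 * (φ.boxSize J : ℝ) + 1) ≤ φ.errorTerm J ∧
      (φ.boxSize J : ℝ) * ((φ.r j).re)⁻¹ ≤ φ.errorTerm J := by
  set R := φ.errorTerm J with hR
  set N := φ.boxSize J with hN
  have hr := (hJ j hj).2
  have hle : (φ.r j).re ^ (-(1 / 4) : ℝ) ≤ R := φ.rpow_le_errorTerm hj
  have hR0 : 0 < R := (Real.rpow_pos_of_pos hr _).trans_le hle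
  have hN1 : (N : ℝ) * R ≤ 1 := by
    have := Nat.floor_le (inv_pos.mpr hR0).le
    calc (N : ℝ) * R ≤ R⁻¹ * R := mul_le_mul_of_nonneg_right this hR0.le
      _ = 1 := inv_mul_cancel₀ hR0.ne'
  -- `r_j⁻¹ ≤ R⁴` and `N R ≤ 1`, so `N / r_j ≤ R³`, and `R ≤ 1` unless `N = 0`
  have hr4 : ((φ.r j).re)⁻¹ ≤ R ^ 4 := by
    have h := pow_le_pow_left₀ (Real.rpow_nonneg hr.le _) hle 4
    rw [← Real.rpow_natCast, ← Real.rpow_mul hr.le] at h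
    norm_num [Real.rpow_neg_one] at h
    exact h
  constructor
  · have h1 : R⁻¹ < N + 1 := Nat.lt_floor_add_one _
    rw [div_le_iff₀ (by positivity)]
    have h2 : R * R⁻¹ ≤ R * (N + 1) := mul_le_mul_of_nonneg_left h1.le hR0.le
    rw [mul_inv_cancel₀ hR0.ne'] at h2
    have h3 : 0 ≤ R * N := by positivity
    linarith
  · rcases Nat.eq_zero_or_pos N with h0 | h0
    · rw [h0, Nat.cast_zero, zero_mul]
      exact hR0.le
    · have h1 : (1 : ℝ) ≤ N := by exact_mod_cast h0
      have hR1 : R ≤ 1 := le_trans (le_mul_of_one_le_left hR0.le h1) hN1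
      calc (N : ℝ) * ((φ.r j).re)⁻¹ ≤ N * R ^ 4 := mul_le_mul_of_nonneg_left hr4 (by positivity)
        _ = (N * R) * (R ^ 3) := by ring
        _ ≤ 1 * R ^ 3 := mul_le_mul_of_nonneg_right hN1 (by positivity)
        _ = R * (R ^ 2) := by ring
        _ ≤ R * 1 := mul_le_mul_of_nonneg_left (pow_le_one₀ hR0.le hR1) hR0.le
        _ = R := mul_one R

/-- On nonnegative functions the state `⟨a Φ, Φ⟩` is a nonnegative real number. -/
theorem integral_state_nonneg {a f : Y Γ → ℂ} (ν : Measure (Y Γ))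
    (h : ∀ y, (a y).im = 0 ∧ 0 ≤ (a y).re) :
    0 ≤ (∫ y, a y * f y * conj (f y) ∂ν).re ∧ (∫ y, a y * f y * conj (f y) ∂ν).im = 0 := by
  have hpt : ∀ y, a y * f y * conj (f y) = (((a y).re * ‖f y‖ ^ 2 : ℝ) : ℂ) := by
    intro y
    rw [mul_assoc, Complex.mul_conj, Complex.normSq_eq_norm_sq, Complex.ofReal_mul]
    congr 1
    exact Complex.ext rfl (h y).1
  simp only [hpt, integral_complex_ofReal, Complex.ofReal_re, Complex.ofReal_im, and_true]
  exact integral_nonneg fun y => mul_nonneg (h y).2 (by positivity)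

theorem integral_toLp {ν : Measure (Y Γ)} (a : Y Γ → ℂ) {f : Y Γ → ℂ} (hf : MemLp f 2 ν) :
    ∫ y, a y * (hf.toLp f) y * conj ((hf.toLp f) y) ∂ν = ∫ y, a y * f y * conj (f y) ∂ν := by
  refine integral_congr_ae ?_
  filter_upwards [hf.coeFn_toLp] with y hy
  rw [hy]

variable [DiscreteTopology Γ] [CompactSpace (Y Γ)] [μ.IsHaarMeasure] {a : Y Γ → ℂ}
  {J : Finset (Fin d)} {φ : LaplaceEigenfunction Γ μ}

theorem integral_boxState (φ : LaplaceEigenfunction Γ μ) (ha : IsSmooth a) (J : Finset (Fin d))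
    (N : ℕ) : ∫ y, a y * φ.boxState J N y * conj (φ.boxState J N y) ∂(quotientMeasure Γ μ) =
      ((box J N).card : ℂ)⁻¹ * ∑ n ∈ box J N, ∑ m ∈ box J N, φ.matCoeff a n m := by
  have hsq : ((√((box J N).card : ℝ))⁻¹ : ℝ) * ((√((box J N).card : ℝ))⁻¹ : ℝ) =
      (((box J N).card : ℂ)⁻¹ : ℂ) := by
    rw [← Complex.ofReal_mul, ← mul_inv, Real.mul_self_sqrt (Nat.cast_nonneg _)]
    push_cast
    rfl
  have hpt : ∀ y, a y * φ.boxState J N y * conj (φ.boxState J N y) = ((box J N).card : ℂ)⁻¹ *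
      ∑ n ∈ box J N, ∑ m ∈ box J N, a y * φ.fn n y * conj (φ.fn m y) := by
    intro y
    simp only [boxState, map_mul, Complex.conj_ofReal, map_sum, ← Finset.mul_sum]
    rw [← Finset.sum_mul, ← Finset.mul_sum, ← hsq]
    ring
  simp only [hpt]
  rw [integral_const_mul, integral_finsetSum _ fun n _ =>
    integrable_finsetSum _ fun m _ => φ.integrable_matCoeff ha n m]
  congr 1
  refine Finset.sum_congr rfl fun n _ => ?_
  rw [integral_finsetSum _ fun m _ => φ.integrable_matCoeff ha n m]
  rfl

theorem memLp_boxState (φ : LaplaceEigenfunction Γ μ) (J : Finset (Fin d)) (N : ℕ) :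
    MemLp (φ.boxState J N) 2 (quotientMeasure Γ μ) := by
  have := isFiniteMeasure_quotientMeasure (Γ := Γ) (μ := μ)
  obtain ⟨C, -, hC⟩ := (φ.isSmooth_boxState J N).exists_bound
  exact .of_bound ((φ.isSmooth_boxState J N).aestronglyMeasurable _) C (Eventually.of_forall hC)

theorem norm_toLp_boxState (hJ : ∀ j ∈ J, (φ.r j).im = 0) (N : ℕ) :
    ‖(φ.memLp_boxState J N).toLp‖ = 1 := by
  have h1 : ∫ y, 1 * φ.boxState J N y * conj (φ.boxState J N y) ∂(quotientMeasure Γ μ) = 1 := by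
    rw [integral_boxState φ (isSmooth_const 1)]
    have hin : ∀ n ∈ box J N, ∑ m ∈ box J N, φ.matCoeff (fun _ => 1) n m = 1 := by
      intro n hn
      rw [Finset.sum_eq_single_of_mem n hn fun m _ hmn => ?_,
        matCoeff_one_eq_one hJ (mem_box.mp hn).2]
      obtain ⟨j, hj⟩ := Function.ne_iff.mp hmn
      exact matCoeff_eq_zero (j := j) (isSmooth_const 1) (fun _ _ => rfl) (Ne.symm hj)
    rw [Finset.sum_congr rfl hin, Finset.sum_const, nsmul_eq_mul, mul_one, inv_mul_cancel₀]
    exact_mod_cast (card_box_pos J N).ne'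
  have h2 : ((‖(φ.memLp_boxState J N).toLp‖ : ℂ)) ^ 2 = 1 := by
    have h3 := inner_self_eq_norm_sq_to_K (𝕜 := ℂ) (φ.memLp_boxState J N).toLp
    refine h3.symm.trans (Eq.trans ?_ h1)
    rw [L2.inner_def]
    refine integral_congr_ae ?_
    filter_upwards [(φ.memLp_boxState J N).coeFn_toLp] with y hy
    rw [hy, RCLike.inner_apply, one_mul]
  have h4 : ‖(φ.memLp_boxState J N).toLp‖ ^ 2 = 1 := by exact_mod_cast h2
  exact (pow_eq_one_iff_of_nonneg (norm_nonneg _) two_ne_zero).mp h4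

theorem partialLift_eq (φ : LaplaceEigenfunction Γ μ) (ha : IsSmooth a) (N : ℕ) :
    φ.partialLift a N = ∑ n ∈ Finset.Icc (fun _ : Fin d => -(N : ℤ)) (fun _ => (N : ℤ)),
      φ.matCoeff a n 0 := by
  simp only [partialLift, matCoeff, Finset.mul_sum, Finset.sum_mul]
  exact integral_finsetSum _ fun n _ => φ.integrable_matCoeff ha n 0

theorem tendsto_partialLift (ha : IsSmooth a) (hs : Summable fun k => φ.matCoeff a k 0) :
    Tendsto (φ.partialLift a) atTop (𝓝 (∑' k, φ.matCoeff a k 0)) := by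
  have h1 : Tendsto (fun N : ℕ => Finset.Icc (fun _ : Fin d => -(N : ℤ)) (fun _ => (N : ℤ)))
      atTop atTop := by
    refine tendsto_atTop_finset_of_monotone (fun M N h => ?_) fun k => ?_
    · refine Finset.Icc_subset_Icc (fun _ => ?_) fun _ => ?_ <;> simpa using h
    · refine ⟨∑ j, (k j).natAbs, Finset.mem_Icc.mpr ⟨fun j => ?_, fun j => ?_⟩⟩ <;>
      · have := Finset.single_le_sum (f := fun j => (k j).natAbs) (fun i _ => Nat.zero_le _)
          (Finset.mem_univ j)
        simp only at this ⊢
        omega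
  exact (hs.hasSum.comp h1).congr fun N => (φ.partialLift_eq ha N).symm

/-- The comparison of the micro local lift with the states of boxes of side `boxSize`. -/
theorem exists_lift_bound (ha : IsSmooth a) (J : Finset (Fin d))
    (hinv : ∀ j ∉ J, IsInvariantUnderK j a) :
    ∃ C : ℝ, ∀ φ : LaplaceEigenfunction Γ μ, (∀ j ∈ J, (φ.r j).im = 0 ∧ 0 < (φ.r j).re) →
      Tendsto (φ.partialLift a) atTop (𝓝 (φ.lift a)) ∧
      ‖φ.lift a - ∫ y, a y * φ.boxState J (φ.boxSize J) y *
        conj (φ.boxState J (φ.boxSize J) y) ∂(quotientMeasure Γ μ)‖ ≤ C * φ.errorTerm J := by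
  obtain ⟨A, hA, hdec⟩ := exists_decay (μ := μ) ha
  obtain ⟨C, hC, hsh⟩ := exists_shift_bound (μ := μ) ha
  have hS0 : 0 ≤ ∑' k : Fin d → ℤ, decayWeight k := tsum_nonneg fun k => (decayWeight_pos k).le
  refine ⟨(J.card * (C + A)) * ∑' k : Fin d → ℤ, decayWeight k, fun φ hJ => ?_⟩
  have hJ' : ∀ j ∈ J, (φ.r j).im = 0 := fun j hj => (hJ j hj).1
  set N := φ.boxSize J with hN
  set R := φ.errorTerm J with hR
  have hzero : ∀ k : Fin d → ℤ, (∃ i ∉ J, k i ≠ 0) → φ.matCoeff a k 0 = 0 :=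
    fun k ⟨i, hi, hki⟩ => matCoeff_eq_zero ha (hinv i hi) hki
  have hdecay : ∀ k : Fin d → ℤ, ‖φ.matCoeff a k 0‖ ≤ A * decayWeight k ∧
      ∀ j, |(k j : ℝ)| * ‖φ.matCoeff a k 0‖ ≤ A * decayWeight k := by
    intro k
    by_cases hk : ∃ i ∉ J, k i ≠ 0
    · have := mul_nonneg hA (decayWeight_pos k).le
      rw [hzero k hk, norm_zero]
      exact ⟨this, fun j => by rwa [mul_zero]⟩
    · push Not at hk
      obtain ⟨h1, h2⟩ := hdec φ J hJ' k 0 hk fun i _ => rfl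
      rw [sub_zero] at h1 h2
      exact ⟨h1, fun j => le_trans
        (mul_le_mul_of_nonneg_right (by linarith) (norm_nonneg _)) (h2 j)⟩
  have hsum : Summable fun k => φ.matCoeff a k 0 :=
    .of_norm_bounded (summable_decayWeight.mul_left A) fun k => (hdecay k).1
  have htend := tendsto_partialLift ha hsum
  have hlift : φ.lift a = ∑' k, φ.matCoeff a k 0 := htend.limUnder_eq
  refine ⟨by rwa [hlift], ?_⟩
  set D : ℝ := ∑ j ∈ J, N * (C * ((φ.r j).re)⁻¹) with hD
  have hD0 : 0 ≤ D := Finset.sum_nonneg fun j hj => by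
    have := (hJ j hj).2
    positivity
  have hshift : ∀ k : Fin d → ℤ, (∀ i ∉ J, k i = 0) → ∀ m ∈ box J N,
      ‖φ.matCoeff a (k + m) m - φ.matCoeff a k 0‖ ≤ D * decayWeight k := by
    intro k hk m hm
    obtain ⟨hmJ, hm0⟩ := mem_box.mp hm
    have h := norm_sub_zero_le_of_step (F := fun m => φ.matCoeff a (k + m) m) (J := J)
      (ε := fun j => C * ((φ.r j).re)⁻¹ * decayWeight k) (fun j hj m hm => by
        have h1 := hsh φ J hJ j hj (k + m) m (fun i hi => by simp [hk i hi, hm i hi]) hm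
        have h2 : k + Function.update m j (m j + 1) =
            Function.update (k + m) j ((k + m) j + 1) := by
          funext i
          by_cases hi : i = j
          · subst hi; simp [add_assoc]
          · simp [hi]
        rw [add_sub_cancel_right] at h1
        rwa [h2]) hm0
    simp only [add_zero] at h
    refine h.trans ?_
    rw [hD, Finset.sum_mul]
    refine Finset.sum_le_sum fun j hj => ?_
    have h3 : |(m j : ℝ)| ≤ N := by
      have := Finset.mem_Icc.mp (hmJ j hj)
      rw [abs_le]
      exact ⟨by exact_mod_cast this.1, by exact_mod_cast this.2⟩
    have h4 : 0 ≤ C * ((φ.r j).re)⁻¹ * decayWeight k :=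
      mul_nonneg (mul_nonneg hC (inv_pos.mpr (hJ j hj).2).le) (decayWeight_pos k).le
    calc _ ≤ N * (C * ((φ.r j).re)⁻¹ * decayWeight k) := mul_le_mul_of_nonneg_right h3 h4
      _ = _ := by ring
  have hmain := norm_tsum_sub_average_le hD0 hzero (fun k => (hdecay k).1)
    (fun k => (hdecay k).2) hshift
  rw [integral_boxState φ ha, hlift]
  refine hmain.trans ?_
  rw [mul_right_comm]
  refine mul_le_mul_of_nonneg_right ?_ hS0
  have h1 : D ≤ ∑ _j ∈ J, C * R := Finset.sum_le_sum fun j hj => by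
    rw [mul_left_comm]
    exact mul_le_mul_of_nonneg_left (boxSize_bounds hJ hj).2 hC
  have h2 : (J.card : ℝ) * (A / (2 * N + 1)) ≤ ∑ _j ∈ J, A * R := by
    rw [← nsmul_eq_mul, ← Finset.sum_const]
    refine Finset.sum_le_sum fun j hj => ?_
    rw [div_eq_mul_one_div]
    exact mul_le_mul_of_nonneg_left (boxSize_bounds hJ hj).1 hA
  rw [Finset.sum_const, nsmul_eq_mul] at h1 h2
  linarith

end LaplaceEigenfunction

end MicrolocalLift

end

theorem mainTheorem6 (d : ℕ) (Γ : Subgroup (MicrolocalLift.G d))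
    (hΓ : MicrolocalLift.IsIrreducibleCocompactLattice Γ)
    (μ : Measure (MicrolocalLift.G d)) [μ.IsHaarMeasure] :
    ∃ Φ : MicrolocalLift.LaplaceEigenfunction Γ μ → Finset (Fin d) →
        Lp ℂ 2 (MicrolocalLift.quotientMeasure Γ μ),
      (∀ φ J, ‖Φ φ J‖ = 1) ∧
      ∀ (J : Finset (Fin d)) (a : MicrolocalLift.Y Γ → ℂ), MicrolocalLift.IsSmooth a →
        (∀ j ∉ J, MicrolocalLift.IsInvariantUnderK j a) →
        ∃ C : ℝ, ∀ φ : MicrolocalLift.LaplaceEigenfunction Γ μ,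
          (∀ j ∈ J, (φ.r j).im = 0 ∧ 0 < (φ.r j).re) →
          Tendsto (φ.partialLift a) atTop (𝓝 (φ.lift a)) ∧
          ‖φ.lift a - ∫ y, a y * Φ φ J y * conj (Φ φ J y) ∂(MicrolocalLift.quotientMeasure Γ μ)‖
            ≤ C * ⨆ j : J, (φ.r j).re ^ (-(1 / 4) : ℝ) ∧
          ((∀ y, (a y).im = 0 ∧ 0 ≤ (a y).re) →
            -(C * ⨆ j : J, (φ.r j).re ^ (-(1 / 4) : ℝ)) ≤ (φ.lift a).re ∧
            |(φ.lift a).im| ≤ C * ⨆ j : J, (φ.r j).re ^ (-(1 / 4) : ℝ)) := by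
  classical
  have := hΓ.discrete
  have := hΓ.cocompact
  -- if some `r_j`, `j ∈ J`, is not real and positive, take `Φ = φ_0`, the case `J = ∅`
  let J' : MicrolocalLift.LaplaceEigenfunction Γ μ → Finset (Fin d) → Finset (Fin d) :=
    fun φ J => if ∀ j ∈ J, (φ.r j).im = 0 ∧ 0 < (φ.r j).re then J else ∅
  refine ⟨fun φ J => (φ.memLp_boxState (J' φ J) (φ.boxSize (J' φ J))).toLp, fun φ J => ?_,
    fun J a ha hinv => ?_⟩
  · refine MicrolocalLift.LaplaceEigenfunction.norm_toLp_boxState (fun j hj => ?_) _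
    by_cases h : ∀ j ∈ J, (φ.r j).im = 0 ∧ 0 < (φ.r j).re
    · simp only [J', if_pos h] at hj
      exact (h j hj).1
    · simp [J', if_neg h] at hj
  · obtain ⟨C, hCb⟩ :=
      MicrolocalLift.LaplaceEigenfunction.exists_lift_bound (μ := μ) ha J hinv
    refine ⟨C, fun φ hJ => ?_⟩
    have hJ' : J' φ J = J := if_pos hJ
    obtain ⟨htend, hb⟩ := hCb φ hJ
    refine ⟨htend, ?_, fun hpos => ?_⟩
    · rw [MicrolocalLift.LaplaceEigenfunction.integral_toLp, hJ']
      exact hb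
    · obtain ⟨hre, him⟩ := MicrolocalLift.LaplaceEigenfunction.integral_state_nonneg
        (f := φ.boxState J (φ.boxSize J)) (MicrolocalLift.quotientMeasure Γ μ) hpos
      have h1 := (Complex.abs_re_le_norm _).trans hb
      have h2 := (Complex.abs_im_le_norm _).trans hb
      rw [Complex.sub_re, abs_le] at h1
      rw [Complex.sub_im, him, sub_zero] at h2
      exact ⟨h1.1.trans (sub_le_self _ hre), h2⟩
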